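/- Let $N\ge 1$ and let $\mathcal{A}=[a_{ij}]\in\mathbb{R}^{N\times N}$ be the weighted adjacency matrix ($a_{ii}=0$, $a_{ij}=a_{ji}\ge 0$) of a connected undirected graph on $\{1,\dots,N\}$, where $i$ and $j$ are joined if and only if $a_{ij}>0$. Consider agents $$\dot x_i=g_i(x_i,u_i),\qquad y_i=h_i(x_i),\qquad x_i\in\mathbb{R}^{n_i},\ u_i,y_i\in\mathbb{R},\qquad i=1,\dots,N,$$ with $g_i,h_i$ smooth, and the resource allocation problem of minimizing $\sum_{i=1}^N f_i(y_i)$ subject to $\sum_{i=1}^N y_i=\sum_{i=1}^N d_i^0$, where $d_i^0\in\mathbb{R}$. Agent $i$ only measures $d_i(t)=d_i^0+\sum_{j=1}^{k_i}A_{ij}\sin(\omega_{ij}t+\varphi_{ij})$, with known distinct frequencies $\omega_{ij}>0$ and unknown $A_{ij},\varphi_{ij}\in\mathbb{R}$. Assume, for each $i$: 1. $f_i:\mathbb{R}\to\mathbb{R}$ is $C^2$ and $0<\underline h_i\le f_i''(s)\le\overline h_i<\infty$ for all $s\in\mathbb{R}$; $y^*=(y_1^*,\dots,y_N^*)$ denotes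 the optimal solution of the allocation problem. 2. There is a unique pair of smooth functions $\mathbf{x}_i:\mathbb{R}\to\mathbb{R}^{n_i}$, $\mathbf{u}_i:\mathbb{R}\to\mathbb{R}$ with $g_i(\mathbf{x}_i(r),\mathbf{u}_i(r))=0$ and $h_i(\mathbf{x}_i(r))=r$ for all $r\in\mathbb{R}$, and $\mathbf{u}_i$ is $M_i$-Lipschitz. Put $x_i^*=\mathbf{x}_i(y_i^*)$ and $u_i^*=\mathbf{u}_i(y_i^*)$. 3. Agent $i$ is exponentially passive (hence passive) with respect to $(y_i^*,x_i^*,u_i^*)$: there are a $C^1$ function $V_i:\mathbb{R}^{n_i}\to\mathbb{R}$ and constants $c_1,c_2,c_3>0$ (possibly depending on $i$) with, for all $x\in\mathbb{R}^{n_i}$ and $u\in\mathbb{R}$, $c_1\|x-x_i^*\|^2\le V_i(x)\le c_2\|x-x_i^*\|^2$ and $$\nabla V_i(x)^\top g_i(x,u)\le -c_3\|x-x_i^*\|^2+(h_i(x)-y_i^*)(u-u_i^*).$$ Let $S_i=\mathrm{diag}\left(0,\begin{bmatrix}0&\omega_{i1}\\-\omega_{i1}&0\end{bmatrix},\dots,\begin{bmatrix}0&\omega_{ik_i}\\-\omega_{ik_i}&0\end{bmatrix}\right)$,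 $D_i=[1,1,0,\dots,1,0]$ and $D_i^\epsilon=[0,1,0,\dots,1,0]$ (both of length $2k_i+1$), let $L_i\in\mathbb{R}^{2k_i+1}$ be such that $S_i-L_iD_i$ is Hurwitz, and consider the distributed controller with gain $\gamma\in\mathbb{R}$ $$\begin{aligned}u_i&=-\gamma f_i'(y_i)+\lambda_i+\mathbf{u}_i(y_i),\\ \dot\lambda_i&=-\sum_{j}a_{ij}(\lambda_i-\lambda_j)-\sum_{j}a_{ij}(z_i-z_j)+d_i-y_i-D_i^\epsilon\eta_i,\\ \dot\eta_i&=(S_i-L_iD_i)\eta_i+L_id_i,\\ \dot z_i&=\sum_{j}a_{ij}(\lambda_i-\lambda_j).\end{aligned}$$ Then there is a number $\gamma_0$, depending only on the matrix $\mathcal{A}$, the frequencies $\omega_{ij}$, the gains $L_i$, the lower bounds $\underline h_i$ and the constants $M_i$, such that for every $\gamma>\gamma_0$ the controller solves the coordination problem exponentially: there is a rate $c>0$, independent of the $A_{ij},\varphi_{ij}$ and of the initial values, such that for all $A_{ij},\varphi_{ij}$ the closed-loop system has a solution on $[0,\infty)$ for every initial value $(x_i(0),\lambda_i(0),\eta_i(0),z_i(0))_{i=1}^N$,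 and along every solution on $[0,\infty)$ the agent states $x_i(t)$ are bounded and there is a constant $C$ (depending on the solution) with $$|y_i(t)-y_i^*|\le C e^{-ct}\qquad\text{for all } t\ge 0,\ i=1,\dots,N.$$ -/

import Mathlib

open Set Filter Topology
open scoped NNReal ContDiff

/-- The state space `ℝⁿ` with its Euclidean norm. -/
abbrev State (n : ℕ) : Type := EuclideanSpace ℝ (Fin n)

/-! ### Communication graph -/

/-- `a` is the weighted adjacency matrix of an undirected graph without self-loops. -/
structure IsUndirectedWeights {N : ℕ} (a : Matrix (Fin N) (Fin N) ℝ) : Prop where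
  diag : ∀ i, a i i = 0
  symm : ∀ i j, a i j = a j i
  nonneg : ∀ i j, 0 ≤ a i j

/-- The undirected graph of a weight matrix: `i` and `j` are joined iff `a i j > 0`. -/
def weightGraph {N : ℕ} (a : Matrix (Fin N) (Fin N) ℝ) : SimpleGraph (Fin N) :=
  SimpleGraph.fromRel fun i j => 0 < a i j

/-- The local relative information `vᵢᵛ = ∑ⱼ aᵢⱼ (vᵢ - vⱼ)`. -/
def relInfo {N : ℕ} (a : Matrix (Fin N) (Fin N) ℝ) (v : Fin N → ℝ) (i : Fin N) : ℝ :=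
  ∑ j, a i j * (v i - v j)

/-! ### Resource allocation problem -/

/-- `f` is twice continuously differentiable and `lo ≤ f'' ≤ hi` for some finite `hi`. -/
structure IsCost (lo : ℝ) (f : ℝ → ℝ) : Prop where
  smooth : ContDiff ℝ 2 f
  lower : ∀ s, lo ≤ deriv (deriv f) s
  upper : ∃ hi : ℝ, ∀ s, deriv (deriv f) s ≤ hi

/-- `y` minimizes `∑ fᵢ(yᵢ)` subject to `∑ yᵢ = ∑ dᵢ⁰`. -/
def IsOptimalAllocation {N : ℕ} (f : Fin N → ℝ → ℝ) (d0 y : Fin N → ℝ) : Prop :=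
  ∑ i, y i = ∑ i, d0 i ∧
    ∀ w : Fin N → ℝ, ∑ i, w i = ∑ i, d0 i → ∑ i, f i (y i) ≤ ∑ i, f i (w i)

/-! ### Agents `ẋ = g(x,u)`, `y = h(x)` -/

/-- `(xr, ur)` solves the regulator equations of the agent, and is the only smooth pair of
functions that does so. -/
structure IsRegulator {n : ℕ} (g : State n → ℝ → State n) (h : State n → ℝ)
    (xr : ℝ → State n) (ur : ℝ → ℝ) : Prop where
  smooth_x : ContDiff ℝ ∞ xr
  smooth_u : ContDiff ℝ ∞ ur
  steady : ∀ r, g (xr r) (ur r) = 0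
  output : ∀ r, h (xr r) = r
  unique : ∀ (xr' : ℝ → State n) (ur' : ℝ → ℝ), ContDiff ℝ ∞ xr' → ContDiff ℝ ∞ ur' →
    (∀ r, g (xr' r) (ur' r) = 0) → (∀ r, h (xr' r) = r) → xr' = xr ∧ ur' = ur

/-- Class `𝒦_∞`: continuous, strictly increasing on `[0,∞)`, zero at zero, unbounded. -/
structure IsClassKInfty (α : ℝ → ℝ) : Prop where
  cont : ContinuousOn α (Ici 0)
  mono : StrictMonoOn α (Ici 0)
  zero : α 0 = 0
  unbounded : Tendsto α atTop atTop

/-- Passivity of `ẋ = g(x,u)`, `y = h(x)` with respect to `(h(x*), x*, u*)`. -/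
def IsPassiveAt {n : ℕ} (g : State n → ℝ → State n) (h : State n → ℝ)
    (xs : State n) (us : ℝ) : Prop :=
  ∃ (α₁ α₂ : ℝ → ℝ) (V : State n → ℝ), IsClassKInfty α₁ ∧ IsClassKInfty α₂ ∧ ContDiff ℝ 1 V ∧
    (∀ x, α₁ ‖x - xs‖ ≤ V x ∧ V x ≤ α₂ ‖x - xs‖) ∧
    ∀ x u, fderiv ℝ V x (g x u) ≤ (h x - h xs) * (u - us)

/-- Exponential passivity with respect to `(h(x*), x*, u*)`: strict passivity with quadratic
comparison functions. -/
def IsExpPassiveAt {n : ℕ} (g : State n → ℝ → State n) (h : State n → ℝ)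
    (xs : State n) (us : ℝ) : Prop :=
  ∃ (c₁ c₂ c₃ : ℝ) (V : State n → ℝ), 0 < c₁ ∧ 0 < c₂ ∧ 0 < c₃ ∧ ContDiff ℝ 1 V ∧
    (∀ x, c₁ * ‖x - xs‖ ^ 2 ≤ V x ∧ V x ≤ c₂ * ‖x - xs‖ ^ 2) ∧
    ∀ x u, fderiv ℝ V x (g x u) ≤ -(c₃ * ‖x - xs‖ ^ 2) + (h x - h xs) * (u - us)

/-! ### Observations and observers -/

/-- Index set of the `2k+1` coordinates of an observer: one for the constant mode and one pair
for each of the `k` frequencies. -/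
abbrev ObsIdx (k : ℕ) : Type := Unit ⊕ (Fin 2 × Fin k)

/-- `S = diag(0, [0, w₁; -w₁, 0], …, [0, w_k; -w_k, 0])`. -/
def exoMatrix {k : ℕ} (w : Fin k → ℝ) : Matrix (ObsIdx k) (ObsIdx k) ℝ :=
  Matrix.fromBlocks 0 0 0 (Matrix.blockDiagonal fun j => !![0, w j; -w j, 0])

/-- The row `D^ε = [0, 1, 0, …, 1, 0]`, which reads off the disturbance part of the observer. -/
def distRow (k : ℕ) : ObsIdx k → ℝ :=
  Sum.elim (fun _ => 0) fun p => if p.1 = 0 then 1 else 0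

/-- The row `D = [1, 1, 0, …, 1, 0]`. -/
def obsRow (k : ℕ) : ObsIdx k → ℝ :=
  Sum.elim (fun _ => 1) fun p => if p.1 = 0 then 1 else 0

/-- The observer matrix `S - L D`. -/
def observerMatrix {k : ℕ} (w : Fin k → ℝ) (L : ObsIdx k → ℝ) :
    Matrix (ObsIdx k) (ObsIdx k) ℝ :=
  exoMatrix w - Matrix.vecMulVec L (obsRow k)

/-- A real matrix is Hurwitz if all its complex eigenvalues have negative real part. -/
def IsHurwitz {ι : Type} [Fintype ι] [DecidableEq ι] (A : Matrix ι ι ℝ) : Prop :=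
  ∀ μ ∈ spectrum ℂ (A.map (algebraMap ℝ ℂ)), μ.re < 0

/-- The polluted observation `d(t) = d⁰ + ∑ⱼ Aⱼ sin(wⱼ t + φⱼ)`. -/
noncomputable def observation {k : ℕ} (d0 : ℝ) (w A φ : Fin k → ℝ) (t : ℝ) : ℝ :=
  d0 + ∑ j, A j * Real.sin (w j * t + φ j)

/-! ### Closed loop -/

/-- `(x, λ, η, z)` is a trajectory on `[0, ∞)` of the agents `ẋᵢ = gᵢ(xᵢ,uᵢ)`, `yᵢ = hᵢ(xᵢ)`
under the controller
`uᵢ = -γ fᵢ'(yᵢ) + λᵢ + urᵢ(yᵢ)`, `λ̇ᵢ = -λᵢᵛ - zᵢᵛ + dᵢ - yᵢ - Dᵢ^ε ηᵢ`,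
`η̇ᵢ = (Sᵢ - Lᵢ Dᵢ) ηᵢ + Lᵢ dᵢ`, `żᵢ = λᵢᵛ`. -/
structure IsClosedLoopTrajectory {N : ℕ} {n k : Fin N → ℕ}
    (a : Matrix (Fin N) (Fin N) ℝ) (w : ∀ i, Fin (k i) → ℝ) (L : ∀ i, ObsIdx (k i) → ℝ)
    (γ : ℝ) (g : ∀ i, State (n i) → ℝ → State (n i)) (h : ∀ i, State (n i) → ℝ)
    (f : Fin N → ℝ → ℝ) (ur : Fin N → ℝ → ℝ) (d : Fin N → ℝ → ℝ)
    (x : ∀ i, ℝ → State (n i)) (lam : Fin N → ℝ → ℝ) (η : ∀ i, ℝ → ObsIdx (k i) → ℝ)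
    (z : Fin N → ℝ → ℝ) : Prop where
  agent : ∀ i, ∀ t ≥ 0, HasDerivWithinAt (x i)
    (g i (x i t) (-γ * deriv (f i) (h i (x i t)) + lam i t + ur i (h i (x i t)))) (Ici 0) t
  dual : ∀ i, ∀ t ≥ 0, HasDerivWithinAt (lam i)
    (-relInfo a (fun j => lam j t) i - relInfo a (fun j => z j t) i + d i t - h i (x i t)
      - distRow (k i) ⬝ᵥ η i t) (Ici 0) t
  observer : ∀ i, ∀ t ≥ 0, HasDerivWithinAt (η i)
    ((observerMatrix (w i) (L i)).mulVec (η i t) + d i t • L i) (Ici 0) t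
  aux : ∀ i, ∀ t ≥ 0, HasDerivWithinAt (z i) (relInfo a (fun j => lam j t) i) (Ici 0) t

/-! ### Scalar differential inequalities -/

/-! At the optimum all marginal costs agree, so an equilibrium has `λ` equal to the constant `γ
f_i'(y_i*)`, and `z` solves the Laplacian equation with right-hand side `d_i⁰ - y_i*`, which has
zero sum. Measured from this equilibrium, and with the exosystem state subtracted from `η`, the
observer error obeys a Hurwitz linear equation. It drives the rest of the loop only through an
exponentially small input `ε`. If `γ` is nonnegative and every `γ * lo i` is at least `M i`, strong
convexity outweighs the Lipschitz term `u_i(y_i)`, so each agent stays dissipative with supply `(y_i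
- y_i*) l_i`, where `l` is the error of `λ`.

The sum of the storage functions and of `|l|²/2 + |z|²/2` then decreases up to `ε`, because the
output terms and the coupling of `l` with `z` cancel. It dissipates only the visible part: the agent
errors and `l - avg l`. The error of `z` and the mean of `l` stay hidden. A small multiple of a
cross term recovers them. The derivative of `∑ l_i z_i` contains minus the Laplacian form of `z`,
which is coercive since `∑ z_i = 0` after a suitable choice of equilibrium. For one agent `i₀`, put
`Γ = G(x*, avg l)`; the derivative of `-⟨Γ, x - x*⟩` is `-‖Γ‖²` up to visible and driving terms.
This is `exists_rate_of_cross_term` applied in `exists_rate_errorTrajectory`.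

Control of `avg l` by `‖Γ‖` requires that the input moves the agent at its equilibrium: `‖g(x*, u)‖
≥ κ |u - u*|`. This is not assumed; `IsExpPassiveAt.exists_le_norm` derives it. Near `x*` there are
points whose output deviates by about `σ`, with either sign, and where the gradient of `V` is
`O(σ)`. Passivity there, with the sign of `σ` opposite to that of `u - u*`, bounds `|σ| |u - u*|` by
`O(σ) ‖g(x, u)‖`; division by `|σ|` and the limit `σ → 0` give the bound.

The Lipschitz constants are only local, so the rate on a ball depends on its radius. Trajectories
are bounded, hence decay at some rate and enter a fixed ball; from then on the rate of that ball
applies. Thus the final rate does not depend on the trajectory. Global existence follows from a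
growth bound on the same energy enlarged by the observer errors. -/

theorem antitoneOn_Ici_of_hasDerivWithinAt {T : ℝ} {u u' : ℝ → ℝ}
    (hu : ∀ t ≥ T, HasDerivWithinAt u (u' t) (Ici T) t) (h : ∀ t ≥ T, u' t ≤ 0) :
    AntitoneOn u (Ici T) := by
  refine antitoneOn_of_hasDerivWithinAt_nonpos (f' := u') (convex_Ici T)
    (fun t ht => (hu t ht).continuousWithinAt) (fun t ht => ?_) (fun t ht => ?_)
  · exact (hu t (interior_subset ht)).mono interior_subset
  · exact h t (interior_subset ht)

theorem hasDerivAt_exp_mul (r t : ℝ) :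
    HasDerivAt (fun s => Real.exp (r * s)) (r * Real.exp (r * t)) t := by
  have := ((hasDerivAt_id t).const_mul r).exp
  simpa [mul_comm] using this

/-- A nonnegative function with `u' ≤ -a u + b exp (-r t)` decays exponentially. -/
theorem exists_le_exp_of_deriv_le {T a b r ρ : ℝ} (hρa : ρ ≤ a) (hρr : ρ < r) {u u' : ℝ → ℝ}
    (hu : ∀ t ≥ T, HasDerivWithinAt u (u' t) (Ici T) t) (hu0 : ∀ t ≥ T, 0 ≤ u t)
    (hb : 0 ≤ b) (h : ∀ t ≥ T, u' t ≤ -a * u t + b * Real.exp (-r * t)) :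
    ∃ K : ℝ, ∀ t ≥ T, u t ≤ K * Real.exp (-ρ * t) := by
  have hd : 0 < r - ρ := sub_pos.2 hρr
  -- The second term is minus a primitive of the forcing `b exp (-(r - ρ) t)` left after
  -- multiplication by `exp (ρ t)`, so the sum is nonincreasing.
  set φ : ℝ → ℝ := fun t => Real.exp (ρ * t) * u t + b / (r - ρ) * Real.exp (-(r - ρ) * t)
    with hφ
  have hanti : AntitoneOn φ (Ici T) := by
    refine antitoneOn_Ici_of_hasDerivWithinAt (u' := fun t =>
      (ρ * Real.exp (ρ * t) * u t + Real.exp (ρ * t) * u' t)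
        + b / (r - ρ) * (-(r - ρ) * Real.exp (-(r - ρ) * t))) (fun t ht => ?_) (fun t ht => ?_)
    · exact (((hasDerivAt_exp_mul ρ t).hasDerivWithinAt).mul (hu t ht)).add
        (((hasDerivAt_exp_mul (-(r - ρ)) t).hasDerivWithinAt).const_mul _)
    · have e1 : b / (r - ρ) * (-(r - ρ) * Real.exp (-(r - ρ) * t))
          = -(b * Real.exp (-(r - ρ) * t)) := by field_simp
      have e2 : Real.exp (-(r - ρ) * t) = Real.exp (ρ * t) * Real.exp (-r * t) := by
        rw [← Real.exp_add]; ring_nf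
      have hE := Real.exp_pos (ρ * t)
      rw [e1, e2]
      have h1 := mul_le_mul_of_nonneg_left (h t ht) hE.le
      have h2 : 0 ≤ (a - ρ) * (Real.exp (ρ * t) * u t) :=
        mul_nonneg (sub_nonneg.2 hρa) (mul_nonneg hE.le (hu0 t ht))
      nlinarith
  refine ⟨φ T, fun t ht => ?_⟩
  have h1 := hanti (mem_Ici.2 le_rfl) (mem_Ici.2 ht) ht
  have h2 : Real.exp (ρ * t) * u t ≤ φ T := by
    have : 0 ≤ b / (r - ρ) * Real.exp (-(r - ρ) * t) := by positivity
    simp only [hφ] at h1 ⊢; linarith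
  have h3 : Real.exp (ρ * t) * Real.exp (-ρ * t) = 1 := by
    rw [← Real.exp_add]; simp
  calc u t = (Real.exp (ρ * t) * u t) * Real.exp (-ρ * t) := by
        rw [mul_right_comm, h3, one_mul]
    _ ≤ _ := mul_le_mul_of_nonneg_right h2 (Real.exp_pos _).le

/-- A function with `u' ≤ b exp (-r t) u` is bounded. -/
theorem exists_le_of_deriv_le_exp_mul {b r : ℝ} (hr : 0 < r) (hb : 0 ≤ b) {u u' : ℝ → ℝ}
    (hu : ∀ t ≥ 0, HasDerivWithinAt u (u' t) (Ici 0) t) (hu0 : ∀ t ≥ 0, 0 ≤ u t)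
    (h : ∀ t ≥ 0, u' t ≤ b * Real.exp (-r * t) * u t) :
    ∃ K : ℝ, ∀ t ≥ 0, u t ≤ K := by
  -- Integrating factor for the integrable rate `b exp (-r t)`; since `ψ ≥ 1`, a bound on `u ψ`
  -- bounds `u`.
  set ψ : ℝ → ℝ := fun t => Real.exp (b / r * Real.exp (-r * t)) with hψ
  have hψd : ∀ t, HasDerivAt ψ (ψ t * (b / r * (-r * Real.exp (-r * t)))) t := fun t =>
    ((hasDerivAt_exp_mul (-r) t).const_mul (b / r)).exp
  have hanti : AntitoneOn (fun t => u t * ψ t) (Ici 0) := by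
    refine antitoneOn_Ici_of_hasDerivWithinAt
      (fun t ht => (hu t ht).mul (hψd t).hasDerivWithinAt) (fun t ht => ?_)
    have e1 : b / r * (-r * Real.exp (-r * t)) = -(b * Real.exp (-r * t)) := by field_simp
    rw [e1]
    have := mul_le_mul_of_nonneg_right (h t ht) (Real.exp_pos (b / r * Real.exp (-r * t))).le
    simp only [hψ] at this ⊢
    linarith
  refine ⟨u 0 * ψ 0, fun t ht => ?_⟩
  have h1 := hanti (mem_Ici.2 le_rfl) (mem_Ici.2 ht) ht
  have h2 : 1 ≤ ψ t := Real.one_le_exp (by positivity)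
  calc u t ≤ u t * ψ t := le_mul_of_one_le_right (hu0 t ht) h2
    _ ≤ _ := h1

/-! ### Decay of Hurwitz linear systems -/

/-- Variation of constants: `exp (-μ t) y` has derivative of norm at most `C exp (s t)` with `s =
-Re μ - r > 0`. The strict gap avoids polynomial factors, so the forcing's rate `r` passes unchanged
to `y` and the estimate can be iterated. -/
theorem norm_le_exp_of_hasDerivWithinAt {E : Type*} [NormedAddCommGroup E] [NormedSpace ℂ E]
    {μ : ℂ} {r C : ℝ} (hμ : μ.re < -r) (hC : 0 ≤ C) {y q : ℝ → E}
    (hy : ∀ t ≥ 0, HasDerivWithinAt y (μ • y t + q t) (Ici 0) t)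
    (hq : ∀ t ≥ 0, ‖q t‖ ≤ C * Real.exp (-r * t)) :
    ∃ K : ℝ, 0 ≤ K ∧ ∀ t ≥ 0, ‖y t‖ ≤ K * Real.exp (-r * t) := by
  set s : ℝ := -μ.re - r with hs
  have hs0 : 0 < s := by rw [hs]; linarith
  have hexp : ∀ t : ℝ, HasDerivAt (fun t : ℝ => Complex.exp (-μ * t))
      (Complex.exp (-μ * t) * (-μ)) t := fun t => by
    have h1 : HasDerivAt (fun t : ℝ => -μ * (t : ℂ)) (-μ) t := by
      simpa using (Complex.ofRealCLM.hasDerivAt (x := t)).const_mul (-μ)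
    exact h1.cexp
  have hnorm : ∀ t : ℝ, ‖Complex.exp (-μ * t)‖ = Real.exp (-μ.re * t) := fun t => by
    rw [Complex.norm_exp]; simp
  set φ : ℝ → E := fun t => Complex.exp (-μ * t) • y t with hφ
  have hφd : ∀ t : ℝ, t ≥ 0 → HasDerivWithinAt φ (Complex.exp (-μ * t) • q t) (Ici 0) t := fun t ht => by
    have h1 := (hexp t).hasDerivWithinAt.smul (hy t ht)
    refine h1.congr_deriv ?_
    rw [smul_add, smul_smul]
    module
  set B : ℝ → ℝ := fun t => ‖y 0‖ + C / s * (Real.exp (s * t)) with hB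
  have hbd : ∀ t ≥ 0, ‖φ t‖ ≤ B t := by
    intro t ht
    refine image_norm_le_of_norm_deriv_right_le_deriv_boundary (a := 0) (b := t)
      (f' := fun t => Complex.exp (-μ * t) • q t)
      (B := B) (B' := fun t => C / s * (s * Real.exp (s * t)))
      (fun x hx => ((hφd x hx.1).continuousWithinAt).mono Icc_subset_Ici_self)
      (fun x hx => (hφd x hx.1).mono (Ici_subset_Ici.2 hx.1)) ?_ ?_ ?_ (right_mem_Icc.2 ht)
    · simp only [hφ, hB]; simp; positivity
    · exact fun x => ((hasDerivAt_exp_mul s x).const_mul _).const_add _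
    · intro x hx
      rw [norm_smul, hnorm]
      calc _ ≤ Real.exp (-μ.re * x) * (C * Real.exp (-r * x)) := by gcongr; exact hq x hx.1
        _ = C * (Real.exp (-μ.re * x) * Real.exp (-r * x)) := by ring
        _ = C * Real.exp (s * x) := by rw [← Real.exp_add, hs]; ring_nf
        _ = _ := by field_simp
        _ ≤ _ := le_rfl
  refine ⟨‖y 0‖ + C / s, by positivity, fun t ht => ?_⟩
  have h1 := hbd t ht
  have h2 : ‖y t‖ = Real.exp (μ.re * t) * ‖φ t‖ := by
    simp only [hφ]
    rw [norm_smul, hnorm, ← mul_assoc, ← Real.exp_add]; simp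
  have h3 : Real.exp (μ.re * t) * Real.exp (s * t) = Real.exp (-r * t) := by
    rw [← Real.exp_add, hs]; ring_nf
  have h4 : Real.exp (μ.re * t) ≤ Real.exp (-r * t) := Real.exp_le_exp.2 (by nlinarith)
  calc ‖y t‖ ≤ Real.exp (μ.re * t) * B t := by rw [h2]; gcongr
    _ = Real.exp (μ.re * t) * ‖y 0‖ + C / s * (Real.exp (μ.re * t) * Real.exp (s * t)) := by
      simp only [hB]; ring
    _ ≤ Real.exp (-r * t) * ‖y 0‖ + C / s * Real.exp (-r * t) := by rw [h3]; gcongr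
    _ = _ := by ring

theorem HasDerivWithinAt.mulVec {𝕜 ι κ : Type*} [Fintype ι] [Fintype κ] [RCLike 𝕜]
    (M : Matrix κ ι 𝕜) {e : ℝ → ι → 𝕜} {e' : ι → 𝕜} {s : Set ℝ} {t : ℝ}
    (he : HasDerivWithinAt e e' s t) :
    HasDerivWithinAt (fun t => M.mulVec (e t)) (M.mulVec e') s t := by
  rw [hasDerivWithinAt_pi] at he ⊢
  intro i
  simp only [Matrix.mulVec, dotProduct]
  exact HasDerivWithinAt.fun_sum fun j _ => (he j).const_mul _

/-- Replaces a Jordan form by induction on the roots of an annihilating polynomial: `M e - μ e`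
solves the same equation and is killed by the remaining factors, so it decays. It is then the
forcing in the scalar-coefficient equation `e' = μ e + (M e - μ e)`. -/
theorem exists_norm_le_exp_of_aeval_eq_zero {ι : Type*} [Fintype ι] [DecidableEq ι]
    (M : Matrix ι ι ℂ) {r : ℝ} (s : Multiset ℂ) :
    (∀ μ ∈ s, μ.re < -r) → ∀ e : ℝ → ι → ℂ,
    (∀ t ≥ 0, HasDerivWithinAt e (M.mulVec (e t)) (Ici 0) t) →
    (∀ t, (Polynomial.aeval M (s.map fun μ => Polynomial.X - Polynomial.C μ).prod).mulVec
      (e t) = 0) →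
    ∃ K : ℝ, 0 ≤ K ∧ ∀ t ≥ 0, ‖e t‖ ≤ K * Real.exp (-r * t) := by
  induction s using Multiset.induction_on with
  | empty =>
    intro _ e _ h0
    refine ⟨0, le_rfl, fun t _ => ?_⟩
    have := h0 t
    simp only [Multiset.map_zero, Multiset.prod_zero, map_one, Matrix.one_mulVec] at this
    simp [this]
  | cons μ s ih =>
    intro hs e he h0
    obtain ⟨K, hK, hb⟩ := ih (fun ν hν => hs ν (Multiset.mem_cons_of_mem hν))
      (fun t => M.mulVec (e t) - μ • e t) (fun t ht => by
        refine (((he t ht).mulVec M).sub ((he t ht).const_smul μ)).congr_deriv ?_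
        rw [Matrix.mulVec_sub, Matrix.mulVec_smul]) (fun t => by
        have := h0 t
        rw [Multiset.map_cons, Multiset.prod_cons, mul_comm, map_mul, ← Matrix.mulVec_mulVec]
          at this
        have h2 : (Polynomial.aeval M (Polynomial.X - Polynomial.C μ)).mulVec (e t)
            = M.mulVec (e t) - μ • e t := by
          simp [Matrix.sub_mulVec, Algebra.algebraMap_eq_smul_one, Matrix.smul_mulVec]
        rwa [h2] at this)
    exact norm_le_exp_of_hasDerivWithinAt (hs μ (Multiset.mem_cons_self μ s)) hK
      (fun t ht => (he t ht).congr_deriv (by abel)) hb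

/-- The solutions of a Hurwitz linear system decay exponentially with a common rate. -/
theorem IsHurwitz.exists_rate {ι : Type} [Fintype ι] [DecidableEq ι] {A : Matrix ι ι ℝ}
    (hA : IsHurwitz A) :
    ∃ r > 0, ∀ e : ℝ → ι → ℝ, (∀ t ≥ 0, HasDerivWithinAt e (A.mulVec (e t)) (Ici 0) t) →
      ∃ K : ℝ, 0 ≤ K ∧ ∀ t ≥ 0, ∀ i, |e t i| ≤ K * Real.exp (-r * t) := by
  set M : Matrix ι ι ℂ := A.map (algebraMap ℝ ℂ) with hM
  have hroots : ∀ μ ∈ M.charpoly.roots, μ.re < 0 := fun μ hμ =>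
    hA μ (Matrix.mem_spectrum_of_isRoot_charpoly (Polynomial.isRoot_of_mem_roots hμ))
  obtain ⟨r, hr, hr'⟩ : ∃ r > 0, ∀ μ ∈ M.charpoly.roots, μ.re < -r := by
    have h : ∀ s : Multiset ℂ, (∀ μ ∈ s, μ.re < 0) → ∃ r > 0, ∀ μ ∈ s, μ.re < -r := by
      intro s
      induction s using Multiset.induction_on with
      | empty => exact fun _ => ⟨1, one_pos, by simp⟩
      | cons ν s ih =>
        intro h
        obtain ⟨r, hr, h'⟩ := ih fun μ hμ => h μ (Multiset.mem_cons_of_mem hμ)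
        have hν := h ν (Multiset.mem_cons_self ν s)
        refine ⟨min r (-ν.re / 2), lt_min hr (by linarith), fun μ hμ => ?_⟩
        rcases Multiset.mem_cons.1 hμ with rfl | hμ
        · have := min_le_right r (-μ.re / 2); linarith
        · have := min_le_left r (-ν.re / 2); linarith [h' μ hμ]
    exact h _ hroots
  refine ⟨r, hr, fun e he => ?_⟩
  obtain ⟨K, hK, hb⟩ := exists_norm_le_exp_of_aeval_eq_zero M M.charpoly.roots hr'
    (fun t i => (e t i : ℂ)) (fun t ht => by
      rw [hasDerivWithinAt_pi]
      intro i
      have h1 := (hasDerivWithinAt_pi.1 (he t ht)) i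
      refine h1.ofReal_comp.congr_deriv ?_
      simp [hM, Matrix.mulVec, dotProduct]) (fun t => by
      -- Cayley–Hamilton: the product over all roots of the characteristic polynomial annihilates
      -- every vector.
      rw [← (IsAlgClosed.splits M.charpoly).eq_prod_roots_of_monic M.charpoly_monic,
        Matrix.aeval_self_charpoly, Matrix.zero_mulVec])
  refine ⟨K, hK, fun t ht i => ?_⟩
  have := (norm_le_pi_norm (fun i => (e t i : ℂ)) i).trans (hb t ht)
  simpa using this

/-! ### Global existence of solutions under a Lyapunov growth bound -/

/-- A compactly supported `C¹` vector field has solutions on every interval `[0, T]`. -/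
theorem exists_solution_Icc_of_hasCompactSupport {E : Type*} [NormedAddCommGroup E]
    [NormedSpace ℝ E] [CompleteSpace E] {G : E → E} (hG : ContDiff ℝ 1 G)
    (hs : HasCompactSupport G) (x₀ : E) {T : ℝ} (hT : 0 ≤ T) :
    ∃ α : ℝ → E, α 0 = x₀ ∧ ∀ t ∈ Icc 0 T, HasDerivWithinAt α (G (α t)) (Icc 0 T) t := by
  obtain ⟨K, hK⟩ := hG.lipschitzWith_of_hasCompactSupport hs one_ne_zero
  obtain ⟨B, hB⟩ := hs.exists_bound_of_continuous hG.continuous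
  have hB0 : 0 ≤ B := (norm_nonneg _).trans (hB x₀)
  -- The field is bounded by `B` on the whole space, so a ball of radius `B * T` confines the
  -- solution and one application covers `[0, T]`.
  have hPL : IsPicardLindelof (fun _ => G) (tmin := 0) (tmax := T) ⟨0, left_mem_Icc.2 hT⟩ x₀
      (⟨B * T, mul_nonneg hB0 hT⟩ : ℝ≥0) 0 ⟨B, hB0⟩ K :=
    IsPicardLindelof.of_time_independent (fun x _ => hB x) hK.lipschitzOnWith
      (by simp [hT]; exact le_refl (B * T))
  exact hPL.exists_eq_forall_mem_Icc_hasDerivWithinAt₀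

/-- The field is cut off outside a large ball. Multiplication by a factor in `[0, 1]` preserves the
growth bound on `W`, so the solution of the cut-off equation never leaves the region where the
factor is 1. -/
theorem exists_solution_Icc_of_lyapunov {E : Type*} [NormedAddCommGroup E]
    [NormedSpace ℝ E] [FiniteDimensional ℝ E] {F : E → E} (hF : ContDiff ℝ 1 F)
    {W : E → ℝ} (hW : Differentiable ℝ W) (hW0 : ∀ x, 0 ≤ W x) {K : ℝ} (hK : 0 ≤ K)
    (hKW : ∀ x, fderiv ℝ W x (F x) ≤ K * W x) {R : ℝ} {x₀ : E} {T : ℝ} (hT : 0 ≤ T)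
    (hR : ∀ x, W x ≤ W x₀ * Real.exp (K * T) → ‖x‖ ≤ R) :
    ∃ α : ℝ → E, α 0 = x₀ ∧ ∀ t ∈ Icc 0 T,
      HasDerivWithinAt α (F (α t)) (Icc 0 T) t ∧ ‖α t‖ ≤ R := by
  have : CompleteSpace E := FiniteDimensional.complete ℝ E
  have hR0 : 0 ≤ R := (norm_nonneg x₀).trans (hR x₀ (le_mul_of_one_le_right (hW0 _)
    (Real.one_le_exp (by positivity))))
  let χ : ContDiffBump (0 : E) := ⟨R + 1, R + 2, by linarith, by linarith⟩
  obtain ⟨α, hα0, hα⟩ := exists_solution_Icc_of_hasCompactSupport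
    (G := fun x => χ x • F x) (χ.contDiff.smul hF) χ.hasCompactSupport.smul_right x₀ hT
  have hd : ∀ t ∈ Icc 0 T, HasDerivWithinAt (fun t => W (α t))
      (χ (α t) * fderiv ℝ W (α t) (F (α t))) (Icc 0 T) t := fun t ht => by
    exact ((hW (α t)).hasFDerivAt.comp_hasDerivWithinAt t (hα t ht)).congr_deriv (by simp)
  have hanti : AntitoneOn (fun t => Real.exp (-K * t) * W (α t)) (Icc 0 T) := by
    have hd' : ∀ t ∈ Icc 0 T, HasDerivWithinAt (fun t => Real.exp (-K * t) * W (α t))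
        (-K * Real.exp (-K * t) * W (α t)
          + Real.exp (-K * t) * (χ (α t) * fderiv ℝ W (α t) (F (α t)))) (Icc 0 T) t :=
      fun t ht => ((hasDerivAt_exp_mul (-K) t).hasDerivWithinAt).mul (hd t ht)
    refine antitoneOn_of_hasDerivWithinAt_nonpos (convex_Icc 0 T)
      (fun t ht => (hd' t ht).continuousWithinAt)
      (fun t ht => (hd' t (interior_subset ht)).mono interior_subset) (fun t _ => ?_)
    have h1 : χ (α t) * fderiv ℝ W (α t) (F (α t)) ≤ K * W (α t) := by
      calc _ ≤ χ (α t) * (K * W (α t)) := mul_le_mul_of_nonneg_left (hKW _) χ.nonneg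
        _ ≤ 1 * (K * W (α t)) :=
          mul_le_mul_of_nonneg_right χ.le_one (mul_nonneg hK (hW0 _))
        _ = _ := one_mul _
    nlinarith [mul_le_mul_of_nonneg_left h1 (Real.exp_pos (-K * t)).le]
  have hbd : ∀ t ∈ Icc 0 T, ‖α t‖ ≤ R := fun t ht => by
    refine hR _ ?_
    have h1 := hanti (left_mem_Icc.2 hT) ht ht.1
    simp only [mul_zero, Real.exp_zero, one_mul, hα0] at h1
    have h2 : Real.exp (K * t) * Real.exp (-K * t) = 1 := by rw [← Real.exp_add]; simp
    calc W (α t) = Real.exp (K * t) * (Real.exp (-K * t) * W (α t)) := by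
          rw [← mul_assoc, h2, one_mul]
      _ ≤ Real.exp (K * t) * W x₀ := mul_le_mul_of_nonneg_left h1 (Real.exp_pos _).le
      _ ≤ Real.exp (K * T) * W x₀ := by
          gcongr
          · exact hW0 _
          · exact ht.2
      _ = _ := mul_comm _ _
  refine ⟨α, hα0, fun t ht => ⟨?_, hbd t ht⟩⟩
  have h1 : χ (α t) = 1 := χ.one_of_mem_closedBall (by
    simpa using (hbd t ht).trans (by simp [χ] : R ≤ χ.rIn))
  simpa [h1] using hα t ht

/-- A `C¹` vector field with a nonnegative coercive function growing at most exponentially along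
the field has solutions on `[0, ∞)`. -/
theorem exists_solution_of_lyapunov {E : Type*} [NormedAddCommGroup E]
    [NormedSpace ℝ E] [FiniteDimensional ℝ E] {F : E → E} (hF : ContDiff ℝ 1 F)
    {W : E → ℝ} (hW : Differentiable ℝ W) (hW0 : ∀ x, 0 ≤ W x) {K : ℝ} (hK : 0 ≤ K)
    (hKW : ∀ x, fderiv ℝ W x (F x) ≤ K * W x) (hco : ∀ b, ∃ R, ∀ x, W x ≤ b → ‖x‖ ≤ R)
    (x₀ : E) :
    ∃ α : ℝ → E, α 0 = x₀ ∧ ∀ t ≥ 0, HasDerivWithinAt α (F (α t)) (Ici 0) t := by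
  choose R hR using fun n : ℕ => hco (W x₀ * Real.exp (K * n))
  choose α hα0 hα using fun n : ℕ =>
    exists_solution_Icc_of_lyapunov hF hW hW0 hK hKW (Nat.cast_nonneg n) (hR n)
  have hIci : ∀ (n : ℕ) (t : ℝ), 0 ≤ t → t < n →
      HasDerivWithinAt (α n) (F (α n t)) (Ici 0) t := fun n t h0 h1 => by
    refine ((hα n t ⟨h0, h1.le⟩).1).mono_of_mem_nhdsWithin ?_
    rw [← Ici_inter_Iic]
    exact inter_mem_nhdsWithin _ (Iic_mem_nhds h1)
  -- Both solutions stay in one closed ball, on which the `C¹` field is Lipschitz, so uniqueness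
  -- applies.
  have huniq : ∀ n m : ℕ, n ≤ m → EqOn (α n) (α m) (Icc 0 n) := fun n m hnm => by
    obtain ⟨L, hL⟩ := hF.contDiffOn.exists_lipschitzOnWith one_ne_zero
      (convex_closedBall (0 : E) (max (R n) (R m))) (isCompact_closedBall _ _)
    have hnm' : (n : ℝ) ≤ m := Nat.cast_le.2 hnm
    refine ODE_solution_unique_of_mem_Icc_right (v := fun _ => F)
      (s := fun _ => Metric.closedBall 0 (max (R n) (R m))) (fun t _ => hL)
      (fun t ht => (hα n t ht).1.continuousWithinAt)
      (fun t ht => (hIci n t ht.1 ht.2).mono (Ici_subset_Ici.2 ht.1))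
      (fun t ht => ?_)
      (fun t ht => ((hα m t ⟨ht.1, ht.2.trans hnm'⟩).1.continuousWithinAt).mono
        (Icc_subset_Icc_right hnm'))
      (fun t ht => (hIci m t ht.1 (ht.2.trans_le hnm')).mono (Ici_subset_Ici.2 ht.1))
      (fun t ht => ?_) (by rw [hα0, hα0])
    · simpa using Or.inl (hα n t ⟨ht.1, ht.2.le⟩).2
    · simpa using Or.inr (hα m t ⟨ht.1, (ht.2.trans_le hnm').le⟩).2
  have hglue : ∀ n : ℕ, EqOn (fun t => α (⌊t⌋₊ + 1) t) (α n) (Ico 0 n) := fun n t ht => by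
    have h1 : ⌊t⌋₊ + 1 ≤ n := Nat.succ_le_of_lt ((Nat.floor_lt ht.1).2 ht.2)
    refine huniq _ _ h1 ⟨ht.1, ?_⟩
    push_cast
    exact (Nat.lt_floor_add_one t).le
  -- The index `⌊t⌋₊ + 1` puts `t` strictly before the right end of the interval, so the glued
  -- function agrees with a single solution near `t` in `[0, ∞)`.
  refine ⟨fun t => α (⌊t⌋₊ + 1) t, by simp [hα0], fun t ht => ?_⟩
  have hlt : t < ((⌊t⌋₊ + 1 : ℕ) : ℝ) := by push_cast; exact Nat.lt_floor_add_one t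
  refine (hIci (⌊t⌋₊ + 1) t ht hlt).congr_of_eventuallyEq ?_ rfl
  have hmem : Ico (0:ℝ) ((⌊t⌋₊ + 1 : ℕ) : ℝ) ∈ 𝓝[Ici 0] t := by
    rw [← Ici_inter_Iio]
    exact inter_mem_nhdsWithin _ (Iio_mem_nhds hlt)
  exact Filter.mem_of_superset hmem fun s hs => hglue _ hs

/-! ### The graph Laplacian -/

section Laplacian

variable {N : ℕ} {a : Matrix (Fin N) (Fin N) ℝ}

theorem relInfo_sub (a : Matrix (Fin N) (Fin N) ℝ) (v w : Fin N → ℝ) (i : Fin N) :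
    relInfo a (fun j => v j - w j) i = relInfo a v i - relInfo a w i := by
  simp only [relInfo, ← Finset.sum_sub_distrib]
  exact Finset.sum_congr rfl fun j _ => by ring

theorem relInfo_add (a : Matrix (Fin N) (Fin N) ℝ) (v w : Fin N → ℝ) (i : Fin N) :
    relInfo a (fun j => v j + w j) i = relInfo a v i + relInfo a w i := by
  simp only [relInfo, ← Finset.sum_add_distrib]
  exact Finset.sum_congr rfl fun j _ => by ring

theorem relInfo_const (a : Matrix (Fin N) (Fin N) ℝ) (c : ℝ) (i : Fin N) :
    relInfo a (fun _ => c) i = 0 := by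
  simp [relInfo]

/-- Summation by parts: exchange the indices with `a i j = a j i` and average. Self-adjointness,
positivity and zero column sums of the Laplacian all follow from it. -/
theorem IsUndirectedWeights.two_mul_sum_mul_relInfo (ha : IsUndirectedWeights a)
    (v w : Fin N → ℝ) :
    2 * ∑ i, v i * relInfo a w i = ∑ i, ∑ j, a i j * ((v i - v j) * (w i - w j)) := by
  have h1 : ∑ i, v i * relInfo a w i = ∑ i, ∑ j, a i j * (v i * (w i - w j)) := by
    simp only [relInfo, Finset.mul_sum]
    exact Finset.sum_congr rfl fun i _ => Finset.sum_congr rfl fun j _ => by ring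
  have h2 : ∑ i, v i * relInfo a w i = ∑ i, ∑ j, a i j * (v j * (w j - w i)) := by
    rw [h1, Finset.sum_comm]
    exact Finset.sum_congr rfl fun i _ => Finset.sum_congr rfl fun j _ => by rw [ha.symm j i]
  rw [two_mul]
  nth_rewrite 1 [h1]
  rw [h2]
  simp only [← Finset.sum_add_distrib]
  exact Finset.sum_congr rfl fun i _ => Finset.sum_congr rfl fun j _ => by ring

theorem IsUndirectedWeights.sum_relInfo (ha : IsUndirectedWeights a) (v : Fin N → ℝ) :
    ∑ i, relInfo a v i = 0 := by
  have := ha.two_mul_sum_mul_relInfo (fun _ => 1) v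
  simpa using this

theorem IsUndirectedWeights.sum_mul_relInfo_comm (ha : IsUndirectedWeights a)
    (v w : Fin N → ℝ) : ∑ i, v i * relInfo a w i = ∑ i, w i * relInfo a v i := by
  have h1 := ha.two_mul_sum_mul_relInfo v w
  have h2 := ha.two_mul_sum_mul_relInfo w v
  have : ∑ i, ∑ j, a i j * ((v i - v j) * (w i - w j))
      = ∑ i, ∑ j, a i j * ((w i - w j) * (v i - v j)) := by simp only [mul_comm]
  linarith

/-- The Laplacian quadratic form. -/
def lapForm (a : Matrix (Fin N) (Fin N) ℝ) (v : Fin N → ℝ) : ℝ := ∑ i, v i * relInfo a v i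

theorem IsUndirectedWeights.two_mul_lapForm (ha : IsUndirectedWeights a) (v : Fin N → ℝ) :
    2 * lapForm a v = ∑ i, ∑ j, a i j * (v i - v j) ^ 2 := by
  simp only [lapForm, ha.two_mul_sum_mul_relInfo, sq]

theorem IsUndirectedWeights.lapForm_nonneg (ha : IsUndirectedWeights a) (v : Fin N → ℝ) :
    0 ≤ lapForm a v := by
  have h : 0 ≤ ∑ i, ∑ j, a i j * (v i - v j) ^ 2 :=
    Finset.sum_nonneg fun i _ => Finset.sum_nonneg fun j _ =>
      mul_nonneg (ha.nonneg i j) (sq_nonneg _)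
  linarith [ha.two_mul_lapForm v]

/-- Expand the nonnegative Laplacian form at `v + w`. -/
theorem IsUndirectedWeights.neg_two_mul_sum_mul_relInfo_le (ha : IsUndirectedWeights a)
    (v w : Fin N → ℝ) :
    -(2 * ∑ i, v i * relInfo a w i) ≤ lapForm a v + lapForm a w := by
  have h := ha.lapForm_nonneg (fun i => v i + w i)
  have hc := ha.sum_mul_relInfo_comm v w
  have : lapForm a (fun i => v i + w i) = lapForm a v + lapForm a w
      + ∑ i, v i * relInfo a w i + ∑ i, w i * relInfo a v i := by
    simp only [lapForm, relInfo_add, ← Finset.sum_add_distrib]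
    exact Finset.sum_congr rfl fun i _ => by ring
  linarith

/-- Across an edge the squared difference is a multiple of one summand of the form. Along a path the
bounds combine by `(p + q)² ≤ 2p² + 2q²`, with a constant free of `v`. -/
theorem IsUndirectedWeights.exists_sq_sub_le_lapForm (ha : IsUndirectedWeights a)
    (hconn : (weightGraph a).Connected) (i j : Fin N) :
    ∃ K : ℝ, 0 ≤ K ∧ ∀ v : Fin N → ℝ, (v i - v j) ^ 2 ≤ K * lapForm a v := by
  have hedge : ∀ i j, (weightGraph a).Adj i j →
      ∃ K : ℝ, 0 ≤ K ∧ ∀ v : Fin N → ℝ, (v i - v j) ^ 2 ≤ K * lapForm a v := by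
    intro i j hij
    have hpos : 0 < a i j := by
      rcases hij.2 with h | h
      · exact h
      · rwa [ha.symm]
    refine ⟨2 / a i j, by positivity, fun v => ?_⟩
    have h1 : a i j * (v i - v j) ^ 2 ≤ 2 * lapForm a v := by
      rw [ha.two_mul_lapForm]
      refine le_trans ?_ (Finset.single_le_sum (f := fun i => ∑ j, a i j * (v i - v j) ^ 2)
        (fun i _ => Finset.sum_nonneg fun j _ => mul_nonneg (ha.nonneg i j) (sq_nonneg _))
        (Finset.mem_univ i))
      exact Finset.single_le_sum (f := fun j => a i j * (v i - v j) ^ 2)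
        (fun j _ => mul_nonneg (ha.nonneg i j) (sq_nonneg _)) (Finset.mem_univ j)
    rw [div_mul_eq_mul_div, le_div_iff₀ hpos]
    linarith
  have hr := hconn.preconnected i j
  rw [SimpleGraph.reachable_iff_reflTransGen] at hr
  induction hr with
  | refl => exact ⟨0, le_rfl, by simp⟩
  | @tail k l _ hkl ih =>
    obtain ⟨K, hK, h1⟩ := ih
    obtain ⟨K', hK', h2⟩ := hedge k l hkl
    refine ⟨2 * K + 2 * K', by positivity, fun v => ?_⟩
    nlinarith [h1 v, h2 v, sq_nonneg ((v i - v k) - (v k - v l))]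

/-- The mean of a vector. -/
noncomputable def avg (v : Fin N → ℝ) : ℝ := (∑ i, v i) / N

theorem sum_sub_avg [NeZero N] (v : Fin N → ℝ) : ∑ i, (v i - avg v) = 0 := by
  have : (N : ℝ) ≠ 0 := Nat.cast_ne_zero.2 (NeZero.ne N)
  simp only [Finset.sum_sub_distrib, avg, Finset.sum_const, Finset.card_univ, Fintype.card_fin,
    nsmul_eq_mul]
  field_simp
  ring

theorem sum_sq_eq_add_avg [NeZero N] (v : Fin N → ℝ) :
    ∑ i, v i ^ 2 = ∑ i, (v i - avg v) ^ 2 + N * avg v ^ 2 := by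
  have h1 : ∑ i, v i ^ 2 = ∑ i, ((v i - avg v) ^ 2 + 2 * avg v * (v i - avg v) + avg v ^ 2) :=
    Finset.sum_congr rfl fun i _ => by ring
  rw [h1, Finset.sum_add_distrib, Finset.sum_add_distrib, ← Finset.mul_sum, sum_sub_avg]
  simp

/-- Poincaré inequality on a connected graph. -/
theorem IsUndirectedWeights.exists_sum_sq_sub_avg_le (ha : IsUndirectedWeights a)
    (hconn : (weightGraph a).Connected) [NeZero N] :
    ∃ K > 0, ∀ v : Fin N → ℝ, ∑ i, (v i - avg v) ^ 2 ≤ K * lapForm a v := by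
  choose K hK h using ha.exists_sq_sub_le_lapForm hconn
  have hN : (0 : ℝ) < N := Nat.cast_pos.2 (Nat.pos_of_ne_zero (NeZero.ne N))
  refine ⟨∑ i, ∑ j, K i j + 1, ?_, fun v => ?_⟩
  · have : 0 ≤ ∑ i, ∑ j, K i j := Finset.sum_nonneg fun i _ => Finset.sum_nonneg fun j _ => hK i j
    linarith
  have h1 : ∀ i, (v i - avg v) ^ 2 ≤ ∑ j, (v i - v j) ^ 2 := fun i => by
    have e : v i - avg v = (∑ j, (v i - v j)) / N := by
      simp only [avg, Finset.sum_sub_distrib, Finset.sum_const, Finset.card_univ,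
        Fintype.card_fin, nsmul_eq_mul]
      field_simp
    have cs := sq_sum_le_card_mul_sum_sq (s := Finset.univ) (f := fun j => v i - v j)
    simp only [Finset.card_univ, Fintype.card_fin] at cs
    have hN1 : (1 : ℝ) ≤ N := Nat.one_le_cast.2 (Nat.pos_of_ne_zero (NeZero.ne N))
    have hnn : 0 ≤ ∑ j, (v i - v j) ^ 2 := Finset.sum_nonneg fun j _ => sq_nonneg _
    rw [e, div_pow, div_le_iff₀ (by positivity)]
    nlinarith [mul_le_mul_of_nonneg_right hN1 (mul_nonneg hN.le hnn)]
  calc ∑ i, (v i - avg v) ^ 2 ≤ ∑ i, ∑ j, (v i - v j) ^ 2 := Finset.sum_le_sum fun i _ => h1 i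
    _ ≤ ∑ i, ∑ j, K i j * lapForm a v :=
      Finset.sum_le_sum fun i _ => Finset.sum_le_sum fun j _ => h i j v
    _ = (∑ i, ∑ j, K i j) * lapForm a v := by simp only [Finset.sum_mul]
    _ ≤ _ := mul_le_mul_of_nonneg_right (by linarith) (ha.lapForm_nonneg v)

theorem IsUndirectedWeights.exists_lapForm_le (ha : IsUndirectedWeights a) :
    ∃ K > 0, ∀ (v : Fin N → ℝ) (c : ℝ), lapForm a v ≤ K * ∑ i, (v i - c) ^ 2 := by
  have hA : 0 ≤ ∑ i, ∑ j, a i j :=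
    Finset.sum_nonneg fun i _ => Finset.sum_nonneg fun j _ => ha.nonneg i j
  refine ⟨2 * ∑ i, ∑ j, a i j + 1, by linarith, fun v c => ?_⟩
  have hs : 0 ≤ ∑ i, (v i - c) ^ 2 := Finset.sum_nonneg fun j _ => sq_nonneg _
  have hi : ∀ i, (v i - c) ^ 2 ≤ ∑ i, (v i - c) ^ 2 := fun i =>
    Finset.single_le_sum (f := fun i => (v i - c) ^ 2) (fun j _ => sq_nonneg _)
      (Finset.mem_univ i)
  have h1 : 2 * lapForm a v ≤ ∑ i, ∑ j, a i j * (4 * ∑ i, (v i - c) ^ 2) := by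
    rw [ha.two_mul_lapForm]
    refine Finset.sum_le_sum fun i _ => Finset.sum_le_sum fun j _ =>
      mul_le_mul_of_nonneg_left ?_ (ha.nonneg i j)
    nlinarith [hi i, hi j, sq_nonneg ((v i - c) + (v j - c))]
  simp only [← Finset.sum_mul] at h1
  nlinarith

/-- The Laplacian of a connected graph hits every vector with zero sum. -/
theorem IsUndirectedWeights.exists_relInfo_eq (ha : IsUndirectedWeights a)
    (hconn : (weightGraph a).Connected) [NeZero N] {b : Fin N → ℝ} (hb : ∑ i, b i = 0) (s : ℝ) :
    ∃ z : Fin N → ℝ, (∀ i, relInfo a z i = b i) ∧ ∑ i, z i = s := by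
  have hN : (N : ℝ) ≠ 0 := Nat.cast_ne_zero.2 (NeZero.ne N)
  -- Adding the all-ones matrix to the Laplacian removes its kernel of constants. `T` is injective,
  -- hence surjective; on a zero-sum target the added term vanishes.
  let T : (Fin N → ℝ) →ₗ[ℝ] (Fin N → ℝ) :=
    { toFun := fun v i => relInfo a v i + ∑ j, v j
      map_add' := fun v w => by
        ext i
        have := relInfo_add a v w i
        simp only [Pi.add_apply, Finset.sum_add_distrib]
        rw [show relInfo a (v + w) i = _ from this]
        ring
      map_smul' := fun c v => by
        ext i
        simp only [relInfo, Pi.smul_apply, smul_eq_mul, RingHom.id_apply, mul_add,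
          Finset.mul_sum]
        congr 1
        exact Finset.sum_congr rfl fun j _ => by ring }
  have hT : ∀ v i, T v i = relInfo a v i + ∑ j, v j := fun _ _ => rfl
  have hsum : ∀ v, ∑ i, T v i = N * ∑ j, v j := fun v => by
    simp [hT, Finset.sum_add_distrib, ha.sum_relInfo]
  have hinj : Function.Injective T := by
    rw [← LinearMap.ker_eq_bot, LinearMap.ker_eq_bot']
    intro v hv
    have h0 : ∑ j, v j = 0 := by
      have := hsum v
      rw [hv] at this
      simpa [hN] using this.symm
    have hr : ∀ i, relInfo a v i = 0 := fun i => by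
      have := congrFun hv i
      rw [hT, h0, add_zero] at this
      exact this
    have hq : lapForm a v = 0 := by simp [lapForm, hr]
    ext i
    have hi : ∀ j, v i = v j := fun j => by
      obtain ⟨K, _, h⟩ := ha.exists_sq_sub_le_lapForm hconn i j
      have := h v
      rw [hq, mul_zero] at this
      exact sub_eq_zero.1 (pow_eq_zero_iff two_ne_zero |>.1 (le_antisymm this (sq_nonneg _)))
    have : (N : ℝ) * v i = 0 := by
      rw [← h0, ← Finset.sum_congr rfl fun j _ => hi j]; simp
    simpa [hN] using this
  obtain ⟨z, hz⟩ := (LinearMap.injective_iff_surjective.1 hinj) b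
  have h0 : ∑ j, z j = 0 := by
    have := hsum z
    rw [hz, hb] at this
    simpa [hN] using this.symm
  refine ⟨fun i => z i + s / N, fun i => ?_, ?_⟩
  · rw [relInfo_add a z (fun _ => s / N), relInfo_const, add_zero, ← hz, hT, h0, add_zero]
  · rw [Finset.sum_add_distrib, h0]
    simp
    field_simp

end Laplacian

/-! ### First-order optimality -/

/-- At an optimal allocation all marginal costs agree. -/
theorem IsOptimalAllocation.deriv_eq {N : ℕ} {f : Fin N → ℝ → ℝ} {d0 y : Fin N → ℝ}
    (hf : ∀ i, Differentiable ℝ (f i)) (h : IsOptimalAllocation f d0 y) (i j : Fin N) :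
    deriv (f i) (y i) = deriv (f j) (y j) := by
  by_cases hij : i = j
  · rw [hij]
  -- Moving resource from `j` to `i` preserves the constraint, so the cost is stationary in this
  -- direction.
  let e : Fin N → ℝ := Pi.single i 1 - Pi.single j 1
  have he : ∑ k, e k = 0 := by simp [e, Finset.sum_sub_distrib]
  have hmin : IsLocalMin (fun s : ℝ => ∑ k, f k (y k + s * e k)) 0 := by
    refine Filter.Eventually.of_forall fun s => ?_
    simp only [zero_mul, add_zero]
    refine h.2 _ ?_
    rw [Finset.sum_add_distrib, ← Finset.mul_sum, he, mul_zero, add_zero, h.1]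
  have hd : HasDerivAt (fun s : ℝ => ∑ k, f k (y k + s * e k))
      (∑ k, deriv (f k) (y k) * e k) 0 := by
    refine HasDerivAt.fun_sum fun k _ => ?_
    have h1 : HasDerivAt (fun s : ℝ => y k + s * e k) (e k) 0 := by
      simpa using ((hasDerivAt_id (0 : ℝ)).mul_const (e k)).const_add (y k)
    have h2 : HasDerivAt (f k) (deriv (f k) (y k)) (y k + 0 * e k) := by
      simpa using (hf k (y k)).hasDerivAt
    exact h2.comp 0 h1
  have h0 := hmin.hasDerivAt_eq_zero hd
  have : ∑ k, deriv (f k) (y k) * e k = deriv (f i) (y i) - deriv (f j) (y j) := by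
    simp [e, mul_sub, Finset.sum_sub_distrib, Pi.single_apply]
  linarith

/-! ### Input sensitivity of exponentially passive agents -/

/-- A nonnegative `C¹` function has a point near `p` at which its gradient is controlled by
`V p`: a minimizer of `V + K ‖· - p‖²`. -/
theorem exists_fderiv_le_of_nonneg {n : ℕ} {V : State n → ℝ} (hV : ContDiff ℝ 1 V)
    (hV0 : ∀ x, 0 ≤ V x) {K : ℝ} (hK : 0 < K) (p : State n) :
    ∃ x, K * ‖x - p‖ ^ 2 ≤ V p ∧ ∀ v, |fderiv ℝ V x v| ≤ 2 * K * ‖x - p‖ * ‖v‖ := by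
  have hcont : Continuous fun x => V x + K * ‖x - p‖ ^ 2 := by
    have := hV.continuous
    fun_prop
  obtain ⟨x, hx⟩ := hcont.exists_forall_le' p (by
    filter_upwards [(isCompact_closedBall p (V p / K + 1)).compl_mem_cocompact] with y hy
    have h1 : V p / K + 1 < ‖y - p‖ := by simpa [dist_eq_norm] using hy
    have h2 : 0 ≤ V p / K := div_nonneg (hV0 p) hK.le
    have h3 : V p / K ≤ ‖y - p‖ ^ 2 := by nlinarith
    rw [div_le_iff₀ hK] at h3
    simp only [sub_self, norm_zero]
    nlinarith [hV0 y])
  refine ⟨x, ?_, fun v => ?_⟩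
  · have := hx p
    simp only [sub_self, norm_zero] at this
    nlinarith [hV0 x]
  · have hd : HasFDerivAt (fun x => V x + K * ‖x - p‖ ^ 2)
        (fderiv ℝ V x + K • (2 • (innerSL ℝ (x - p)).comp (ContinuousLinearMap.id ℝ (State n)))) x :=
      ((hV.differentiable one_ne_zero x).hasFDerivAt).add
        ((((hasFDerivAt_id x).sub_const p).norm_sq).const_mul K)
    have hmin : IsLocalMin (fun x => V x + K * ‖x - p‖ ^ 2) x := Filter.Eventually.of_forall hx
    have h0 := congrArg (fun A : State n →L[ℝ] ℝ => A v) (hmin.hasFDerivAt_eq_zero hd)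
    have h1 : fderiv ℝ V x v = -(2 * K * inner ℝ (x - p) v) := by
      simp at h0
      rw [inner_sub_left]
      linarith
    rw [h1, abs_neg, abs_mul, abs_of_pos (by positivity : 0 < 2 * K), mul_assoc]
    nlinarith [abs_real_inner_le_norm (x - p) v]

/-- The input acts nontrivially on an exponentially passive agent at its equilibrium. -/
theorem IsExpPassiveAt.exists_le_norm {n : ℕ} {g : State n → ℝ → State n} {h : State n → ℝ}
    {xr : ℝ → State n} {ur : ℝ → ℝ} {M : ℝ≥0} {ys : ℝ}
    (hg : ∀ u, Continuous fun x => g x u) (hh : ContDiff ℝ 1 h)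
    (hr : IsRegulator g h xr ur) (hM : LipschitzWith M ur)
    (hp : IsExpPassiveAt g h (xr ys) (ur ys)) :
    ∃ κ > 0, ∀ u, κ * |u - ur ys| ≤ ‖g (xr ys) u‖ := by
  obtain ⟨c₁, c₂, c₃, V, hc₁, hc₂, hc₃, hV, hVb, hd⟩ := hp
  have hV0 : ∀ x, 0 ≤ V x := fun x => le_trans (by positivity) (hVb x).1
  set D : ℝ := √(M / c₃) with hD
  have hD2 : D ^ 2 = M / c₃ := Real.sq_sqrt (by positivity)
  -- On the steady states the dissipation inequality has left side zero, which leaves `c₃ ‖xr (ys +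
  -- σ) - xr ys‖² ≤ σ (ur (ys + σ) - ur ys) ≤ M σ²`.
  have hxr : ∀ σ, ‖xr (ys + σ) - xr ys‖ ≤ D * |σ| := fun σ => by
    have h1 := hd (xr (ys + σ)) (ur (ys + σ))
    rw [hr.steady, map_zero, hr.output, hr.output] at h1
    have h2 := hM.dist_le_mul (ys + σ) ys
    simp only [Real.dist_eq, add_sub_cancel_left] at h1 h2
    have h3 : σ * (ur (ys + σ) - ur ys) ≤ M * σ ^ 2 := by
      calc _ ≤ |σ * (ur (ys + σ) - ur ys)| := le_abs_self _
        _ = |σ| * |ur (ys + σ) - ur ys| := abs_mul _ _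
        _ ≤ |σ| * (M * |σ|) := by gcongr
        _ = M * |σ| ^ 2 := by ring
        _ = _ := by rw [sq_abs]
    refine abs_le_of_sq_le_sq' ?_ (by positivity) |>.2
    rw [mul_pow, hD2, sq_abs, div_mul_eq_mul_div, le_div_iff₀ hc₃]
    linarith
  obtain ⟨ℓ, hℓ⟩ := hh.contDiffOn.exists_lipschitzOnWith one_ne_zero
    (convex_closedBall (xr ys) 1) (isCompact_closedBall _ _)
  -- Large enough that the minimizer below is within `|σ| / (2ℓ)` of `xr (ys + σ)` (when `ℓ > 0`);
  -- its output is then within `|σ| / 2` of `ys + σ`.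
  set K : ℝ := 4 * ℓ ^ 2 * (c₂ * D ^ 2) + 1 with hKdef
  have hK : 0 < K := by positivity
  set B : ℝ := √(c₂ * D ^ 2 / K) with hB
  have hB2 : B ^ 2 = c₂ * D ^ 2 / K := Real.sq_sqrt (by positivity)
  have hB0 : 0 ≤ B := Real.sqrt_nonneg _
  have hD0 : 0 ≤ D := Real.sqrt_nonneg _
  have hℓB : ℓ * B ≤ 1 / 2 := by
    refine abs_le_of_sq_le_sq' ?_ (by norm_num) |>.2
    rw [mul_pow, hB2, mul_div_assoc', div_le_iff₀ hK, hKdef]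
    nlinarith
  -- `V` is only `C¹`, so its gradient at `xr (ys + σ)` need not be `O(σ)`. At the minimizer of the
  -- penalized function it is.
  choose x hxV hxd using fun σ => exists_fderiv_le_of_nonneg hV hV0 hK (xr (ys + σ))
  have hxp : ∀ σ, ‖x σ - xr (ys + σ)‖ ≤ B * |σ| := fun σ => by
    refine abs_le_of_sq_le_sq' ?_ (by positivity) |>.2
    have h1 := (hxV σ).trans (hVb _).2
    have h2 : ‖xr (ys + σ) - xr ys‖ ^ 2 ≤ (D * |σ|) ^ 2 := by gcongr; exact hxr σ
    rw [mul_pow, hB2, div_mul_eq_mul_div, le_div_iff₀ hK]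
    nlinarith [mul_le_mul_of_nonneg_left h2 hc₂.le]
  have hxs : ∀ σ, ‖x σ - xr ys‖ ≤ (B + D) * |σ| := fun σ => by
    calc _ = ‖(x σ - xr (ys + σ)) + (xr (ys + σ) - xr ys)‖ := by rw [sub_add_sub_cancel]
      _ ≤ _ := norm_add_le _ _
      _ ≤ _ := by rw [add_mul]; exact add_le_add (hxp σ) (hxr σ)
  have htend : Tendsto x (𝓝 0) (𝓝 (xr ys)) := by
    rw [tendsto_iff_norm_sub_tendsto_zero]
    refine squeeze_zero (fun _ => norm_nonneg _) hxs ?_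
    exact Continuous.tendsto' (by fun_prop) _ _ (by simp)
  have htendr : Tendsto (fun σ => xr (ys + σ)) (𝓝 0) (𝓝 (xr ys)) := by
    have := hr.smooth_x.continuous
    exact Continuous.tendsto' (by fun_prop) _ _ (by simp)
  have hball := Metric.closedBall_mem_nhds (xr ys) one_pos
  have hout : ∀ᶠ σ in 𝓝 (0 : ℝ), |h (x σ) - ys - σ| ≤ |σ| / 2 := by
    filter_upwards [htend hball, htendr hball] with σ h1 h2
    have h3 := hℓ.dist_le_mul _ h1 _ h2
    rw [hr.output, Real.dist_eq, dist_eq_norm] at h3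
    calc |h (x σ) - ys - σ| = |h (x σ) - (ys + σ)| := by ring_nf
      _ ≤ ℓ * ‖x σ - xr (ys + σ)‖ := h3
      _ ≤ ℓ * (B * |σ|) := by gcongr; exact hxp σ
      _ = (ℓ * B) * |σ| := by ring
      _ ≤ 1 / 2 * |σ| := by gcongr
      _ = _ := by ring
  refine ⟨1 / (4 * K * B + 1), by positivity, fun u => ?_⟩
  rw [one_div, inv_mul_le_iff₀ (by positivity)]
  -- The output is displaced against `u - ur ys`, which makes the supply at most `-(s / 2) |u - ur
  -- ys|`; the gradient term must compensate.
  obtain ⟨τ, hτ1, hτ⟩ : ∃ τ : ℝ, |τ| = 1 ∧ τ * (u - ur ys) = -|u - ur ys| := by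
    rcases le_total 0 (u - ur ys) with h0 | h0
    · exact ⟨-1, by simp, by rw [abs_of_nonneg h0]; ring⟩
    · exact ⟨1, by simp, by rw [abs_of_nonpos h0]; ring⟩
  have hτt : Tendsto (fun s : ℝ => s * τ) (𝓝[>] 0) (𝓝 0) :=
    (Continuous.tendsto' (by fun_prop) _ _ (by simp)).mono_left nhdsWithin_le_nhds
  have hlim : Tendsto (fun s : ℝ => (4 * K * B + 1) * ‖g (x (s * τ)) u‖) (𝓝[>] 0)
      (𝓝 ((4 * K * B + 1) * ‖g (xr ys) u‖)) :=
    (((hg u).tendsto _).comp (htend.comp hτt)).norm.const_mul _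
  refine ge_of_tendsto hlim ?_
  filter_upwards [hτt.eventually hout, self_mem_nhdsWithin] with s hs hs0
  have hs0 : 0 < s := hs0
  have habs : |s * τ| = s := by rw [abs_mul, hτ1, mul_one, abs_of_pos hs0]
  have h1 := hd (x (s * τ)) u
  rw [hr.output] at h1
  have h2 := (abs_le.1 (hxd (s * τ) (g (x (s * τ)) u))).1
  have h3 := hxp (s * τ)
  rw [habs] at hs h3
  have h4 : (h (x (s * τ)) - ys) * (u - ur ys) ≤ -(s / 2) * |u - ur ys| := by
    have : (h (x (s * τ)) - ys) * (u - ur ys)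
        = s * (τ * (u - ur ys)) + (h (x (s * τ)) - ys - s * τ) * (u - ur ys) := by ring
    rw [this, hτ]
    have h5 : (h (x (s * τ)) - ys - s * τ) * (u - ur ys) ≤ s / 2 * |u - ur ys| :=
      (le_abs_self _).trans (by rw [abs_mul]; gcongr)
    linarith
  have h5 : 2 * K * ‖x (s * τ) - xr (ys + s * τ)‖ * ‖g (x (s * τ)) u‖
      ≤ 2 * K * (B * s) * ‖g (x (s * τ)) u‖ := by gcongr
  have h6 : 0 ≤ c₃ * ‖x (s * τ) - xr ys‖ ^ 2 := by positivity
  have h7 : s * |u - ur ys| ≤ s * (4 * K * B * ‖g (x (s * τ)) u‖) := by linarith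
  have h8 := le_of_mul_le_mul_left h7 hs0
  nlinarith [norm_nonneg (g (x (s * τ)) u)]

/-! ### Decay by a cross term -/

/-- If `E` dissipates only `P` and a cross term `A` dissipates `H` up to `P`, then `P + H` decays
exponentially, with a rate depending on the constants only. -/
theorem exists_rate_of_cross_term {a c C r : ℝ} (ha : 0 < a) (hc : 0 < c) (hC : 0 < C)
    (hr : 0 < r) :
    ∃ ρ > 0, ∀ (E E' A A' P H e : ℝ → ℝ) (T K : ℝ), 0 ≤ T →
      (∀ t ≥ 0, HasDerivWithinAt E (E' t) (Ici 0) t) →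
      (∀ t ≥ 0, HasDerivWithinAt A (A' t) (Ici 0) t) →
      (∀ t ≥ T, 0 ≤ P t ∧ 0 ≤ H t) →
      (∀ t ≥ T, c * (P t + H t) ≤ E t ∧ E t ≤ C * (P t + H t) ∧ |A t| ≤ C * (P t + H t)) →
      (∀ t ≥ T, E' t ≤ -a * P t + C * √(P t + H t) * e t) →
      (∀ t ≥ T, A' t ≤ -a * H t + C * P t + C * √(P t + H t) * e t) →
      (∀ t ≥ T, 0 ≤ e t ∧ e t ≤ K * Real.exp (-r * t)) →
      ∃ K' : ℝ, ∀ t ≥ T, P t + H t ≤ K' * Real.exp (-ρ * t) := by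
  -- The three bounds respectively keep `E + δ A` above `c / 2 * (P + H)`, let half of `a P` absorb
  -- `δ C P`, and keep the driving terms below `2 C √(P + H) e`.
  set δ : ℝ := min (min (c / (2 * C)) (a / (2 * C))) 1 with hδ
  have hδ0 : 0 < δ := by positivity
  have hδ1 : δ ≤ 1 := min_le_right _ _
  have hδc : δ * C ≤ c / 2 := by
    have : δ ≤ c / (2 * C) := (min_le_left _ _).trans (min_le_left _ _)
    calc δ * C ≤ c / (2 * C) * C := by gcongr
      _ = c / 2 := by field_simp
  have hδa : δ * C ≤ a / 2 := by
    have : δ ≤ a / (2 * C) := (min_le_left _ _).trans (min_le_right _ _)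
    calc δ * C ≤ a / (2 * C) * C := by gcongr
      _ = a / 2 := by field_simp
  refine ⟨min (δ * a / (8 * C)) r, by positivity, ?_⟩
  intro E E' A A' P H e T K hT hE hA hPH hb hE' hA' he
  have key : ∃ K' : ℝ, ∀ t ≥ T, E t + δ * A t
      ≤ K' * Real.exp (-min (δ * a / (8 * C)) r * t) := by
    -- Young's inequality spends half of the dissipation `δ a / 2 * (P + H)` on the driving term and
    -- leaves a multiple of `e²`, hence the rate `2 * r` of the forcing. The other half is compared
    -- with `E + δ A ≤ 2 C (P + H)`.
    refine exists_le_exp_of_deriv_le (T := T) (a := δ * a / (8 * C))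
      (b := 4 * C ^ 2 / (δ * a) * K ^ 2) (r := 2 * r) (ρ := min (δ * a / (8 * C)) r)
      (u := fun t => E t + δ * A t) (u' := fun t => E' t + δ * A' t)
      (min_le_left _ _) ((min_le_right _ _).trans_lt (by linarith))
      (fun t ht => ((hE t (hT.trans ht)).add ((hA t (hT.trans ht)).const_mul δ)).mono
        (Ici_subset_Ici.2 hT)) ?_ (by positivity) ?_
    · intro t ht
      obtain ⟨h1, h2, h3⟩ := hb t ht
      obtain ⟨hP, hH⟩ := hPH t ht
      have h5 : -(C * (P t + H t)) ≤ A t := (abs_le.1 h3).1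
      have hS := add_nonneg hP hH
      nlinarith [mul_le_mul_of_nonneg_left h5 hδ0.le, mul_le_mul_of_nonneg_right hδc hS,
        mul_nonneg hc.le hS]
    · intro t ht
      obtain ⟨h1, h2, h3⟩ := hb t ht
      obtain ⟨hP, hH⟩ := hPH t ht
      obtain ⟨he0, heK⟩ := he t ht
      have hS := add_nonneg hP hH
      set s := √(P t + H t) with hs
      have hs2 : s ^ 2 = P t + H t := Real.sq_sqrt hS
      have hs0 : 0 ≤ s := Real.sqrt_nonneg _
      have hU : E t + δ * A t ≤ 2 * C * (P t + H t) := by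
        have h6 := (abs_le.1 h3).2
        have h7 : δ * A t ≤ 1 * (C * (P t + H t)) := by
          calc δ * A t ≤ δ * (C * (P t + H t)) := by gcongr
            _ ≤ 1 * (C * (P t + H t)) := by gcongr
        linarith
      have hse : 0 ≤ C * s * e t := by positivity
      have hy : 2 * (C * s * e t) ≤ δ * a / 4 * s ^ 2 + 4 * C ^ 2 / (δ * a) * e t ^ 2 := by
        have hq : 0 ≤ (δ * a / 2 * s - 2 * C * e t) ^ 2 / (δ * a) := by positivity
        have : (δ * a / 2 * s - 2 * C * e t) ^ 2 / (δ * a)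
          = δ * a / 4 * s ^ 2 + 4 * C ^ 2 / (δ * a) * e t ^ 2 - 2 * (C * s * e t) := by
          field_simp; ring
        linarith
      have hd : E' t + δ * A' t ≤ -(δ * a / 2) * (P t + H t) + 2 * (C * s * e t) := by
        have h6 := hE' t ht
        have h7 := mul_le_mul_of_nonneg_left (hA' t ht) hδ0.le
        have h8 : δ * (C * s * e t) ≤ C * s * e t := mul_le_of_le_one_left hse hδ1
        have h9 : δ * C * P t ≤ a / 2 * P t := by gcongr
        have h10 : δ * a / 2 * P t ≤ a / 2 * P t := by
          gcongr; exact mul_le_of_le_one_left ha.le hδ1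
        have h11 : 0 ≤ δ * a / 2 * H t := by positivity
        nlinarith
      have he2 : e t ^ 2 ≤ K ^ 2 * Real.exp (-(2 * r) * t) := by
        calc e t ^ 2 ≤ (K * Real.exp (-r * t)) ^ 2 := by gcongr
          _ = K ^ 2 * (Real.exp (-r * t) * Real.exp (-r * t)) := by ring
          _ = _ := by rw [← Real.exp_add]; ring_nf
      have hUs : δ * a / (8 * C) * (E t + δ * A t) ≤ δ * a / 4 * (P t + H t) := by
        calc _ ≤ δ * a / (8 * C) * (2 * C * (P t + H t)) := by gcongr
          _ = _ := by field_simp; ring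
      have he3 : 4 * C ^ 2 / (δ * a) * e t ^ 2
          ≤ 4 * C ^ 2 / (δ * a) * K ^ 2 * Real.exp (-(2 * r) * t) := by
        rw [mul_assoc]; gcongr
      rw [hs2] at hy
      linarith
  obtain ⟨K', hK'⟩ := key
  refine ⟨2 / c * K', fun t ht => ?_⟩
  obtain ⟨h1, h2, h3⟩ := hb t ht
  obtain ⟨hP, hH⟩ := hPH t ht
  have h4 := hK' t ht
  have h5 : -(C * (P t + H t)) ≤ A t := (abs_le.1 h3).1
  have h6 : c / 2 * (P t + H t) ≤ E t + δ * A t := by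
    nlinarith [mul_le_mul_of_nonneg_left h5 hδ0.le,
      mul_le_mul_of_nonneg_right hδc (add_nonneg hP hH)]
  calc P t + H t = 2 / c * (c / 2 * (P t + H t)) := by field_simp
    _ ≤ 2 / c * (K' * Real.exp (-min (δ * a / (8 * C)) r * t)) := by
      exact mul_le_mul_of_nonneg_left (h6.trans h4) (by positivity)
    _ = _ := by ring

/-! ### Dissipative agents -/

/-- An agent `ẋ = G(x, v)` in closed loop with its output feedback, dissipative with respect to the
supply rate `(h x - h xs) v` and with an input that acts nontrivially at the equilibrium. -/
structure IsDissipativeAgent {n : ℕ} (G : State n → ℝ → State n) (h : State n → ℝ)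
    (xs : State n) (V : State n → ℝ) (c₁ c₂ c₃ κ : ℝ) : Prop where
  smooth_field : ContDiff ℝ 1 (fun p : State n × ℝ => G p.1 p.2)
  smooth_output : ContDiff ℝ 1 h
  smooth_storage : ContDiff ℝ 1 V
  lower : ∀ x, c₁ * ‖x - xs‖ ^ 2 ≤ V x
  upper : ∀ x, V x ≤ c₂ * ‖x - xs‖ ^ 2
  dissip : ∀ x v, fderiv ℝ V x (G x v) ≤ -(c₃ * ‖x - xs‖ ^ 2) + (h x - h xs) * v
  steady : G xs 0 = 0
  input : ∀ v, κ * |v| ≤ ‖G xs v‖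

/-- Compactness of balls for `C¹` data. The constant depends on the radius, which is why a rate
uniform over trajectories needs a fixed ball. -/
theorem IsDissipativeAgent.exists_lipschitz {n : ℕ} {G : State n → ℝ → State n}
    {h : State n → ℝ} {xs : State n} {V : State n → ℝ} {c₁ c₂ c₃ κ : ℝ}
    (hG : IsDissipativeAgent G h xs V c₁ c₂ c₃ κ) (R : ℝ) :
    ∃ ℓ > 0,
      (∀ x u v, ‖x - xs‖ ≤ R → |u| ≤ R → |v| ≤ R →
        ‖G x u - G xs v‖ ≤ ℓ * (‖x - xs‖ + |u - v|)) ∧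
      (∀ x, ‖x - xs‖ ≤ R → |h x - h xs| ≤ ℓ * ‖x - xs‖) ∧
      (∀ v, |v| ≤ R → ‖deriv (G xs) v‖ ≤ ℓ) := by
  obtain ⟨ℓ₁, h₁⟩ := hG.smooth_field.contDiffOn.exists_lipschitzOnWith one_ne_zero
    ((convex_closedBall xs R).prod (convex_closedBall (0 : ℝ) R))
    ((isCompact_closedBall _ _).prod (isCompact_closedBall _ _))
  obtain ⟨ℓ₂, h₂⟩ := hG.smooth_output.contDiffOn.exists_lipschitzOnWith one_ne_zero
    (convex_closedBall xs R) (isCompact_closedBall _ _)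
  have hsm : ContDiff ℝ 1 (G xs) :=
    hG.smooth_field.comp (contDiff_const.prodMk contDiff_id : ContDiff ℝ 1 fun v : ℝ => (xs, v))
  obtain ⟨ℓ₃, h₃⟩ := (isCompact_closedBall (0 : ℝ) R).exists_bound_of_continuousOn
    (hsm.continuous_deriv le_rfl).continuousOn
  have e1 : (ℓ₁ : ℝ) ≤ ℓ₁ + ℓ₂ + |ℓ₃| + 1 := by
    have := ℓ₂.coe_nonneg; have := abs_nonneg ℓ₃; linarith
  have e2 : (ℓ₂ : ℝ) ≤ ℓ₁ + ℓ₂ + |ℓ₃| + 1 := by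
    have := ℓ₁.coe_nonneg; have := abs_nonneg ℓ₃; linarith
  have e3 : ℓ₃ ≤ ℓ₁ + ℓ₂ + |ℓ₃| + 1 := by
    have := ℓ₂.coe_nonneg; have := ℓ₁.coe_nonneg; have := le_abs_self ℓ₃; linarith
  refine ⟨ℓ₁ + ℓ₂ + |ℓ₃| + 1, by positivity, fun x u v hx hu hv => ?_, fun x hx => ?_,
    fun v hv => (h₃ v (by simpa using hv)).trans e3⟩
  · have hR : 0 ≤ R := (abs_nonneg u).trans hu
    have := h₁.dist_le_mul (x, u) ⟨by simpa [dist_eq_norm] using hx, by simpa using hu⟩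
      (xs, v) ⟨by simpa using hR, by simpa using hv⟩
    rw [dist_eq_norm, Prod.dist_eq, dist_eq_norm, Real.dist_eq] at this
    refine this.trans (mul_le_mul e1 ?_ (by positivity) (by positivity))
    exact max_le_add_of_nonneg (norm_nonneg _) (abs_nonneg _)
  · have hR : 0 ≤ R := (norm_nonneg _).trans hx
    have := h₂.dist_le_mul x (by simpa [dist_eq_norm] using hx) xs (by simpa using hR)
    rw [dist_eq_norm, dist_eq_norm, Real.norm_eq_abs] at this
    exact this.trans (mul_le_mul_of_nonneg_right e2 (norm_nonneg _))

theorem exists_pos_forall_le {ι : Type*} [Finite ι] {c : ι → ℝ} (hc : ∀ i, 0 < c i) :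
    ∃ d > 0, ∀ i, d ≤ c i := by
  cases isEmpty_or_nonempty ι
  · exact ⟨1, one_pos, fun i => isEmptyElim i⟩
  · obtain ⟨i, hi⟩ := Finite.exists_min c
    exact ⟨c i, hc i, hi⟩

theorem exists_pos_forall_ge {ι : Type*} [Finite ι] (c : ι → ℝ) :
    ∃ d > 0, ∀ i, c i ≤ d := by
  cases isEmpty_or_nonempty ι
  · exact ⟨1, one_pos, fun i => isEmptyElim i⟩
  · obtain ⟨i, hi⟩ := Finite.exists_max c
    exact ⟨|c i| + 1, by positivity, fun j => (hi j).trans (by linarith [le_abs_self (c i)])⟩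

/-! ### The closed loop in error coordinates -/

/-- Trajectories of the closed loop in error coordinates, driven by the observer errors `ε`. -/
structure IsErrorTrajectory {N : ℕ} {n : Fin N → ℕ} (a : Matrix (Fin N) (Fin N) ℝ)
    (G : ∀ i, State (n i) → ℝ → State (n i)) (h : ∀ i, State (n i) → ℝ)
    (xs : ∀ i, State (n i)) (ε : Fin N → ℝ → ℝ)
    (x : ∀ i, ℝ → State (n i)) (l z : Fin N → ℝ → ℝ) : Prop where
  agent : ∀ i, ∀ t ≥ 0, HasDerivWithinAt (x i) (G i (x i t) (l i t)) (Ici 0) t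
  dual : ∀ i, ∀ t ≥ 0, HasDerivWithinAt (l i)
    (-relInfo a (fun j => l j t) i - relInfo a (fun j => z j t) i - (h i (x i t) - h i (xs i))
      - ε i t) (Ici 0) t
  aux : ∀ i, ∀ t ≥ 0, HasDerivWithinAt (z i) (relInfo a (fun j => l j t) i) (Ici 0) t

section ErrorSystem

variable {N : ℕ} {n : Fin N → ℕ} {a : Matrix (Fin N) (Fin N) ℝ}
  {G : ∀ i, State (n i) → ℝ → State (n i)} {h : ∀ i, State (n i) → ℝ}
  {xs : ∀ i, State (n i)} {V : ∀ i, State (n i) → ℝ} {c₁ c₂ c₃ κ : ℝ}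

/-- The storage function of the closed loop in error coordinates. -/
noncomputable def errorEnergy (V : ∀ i, State (n i) → ℝ) (x : ∀ i, State (n i))
    (l z : Fin N → ℝ) : ℝ :=
  ∑ i, V i (x i) + 1 / 2 * ∑ i, l i ^ 2 + 1 / 2 * ∑ i, z i ^ 2

/-- The derivative of `errorEnergy` in the direction `(x', l', z')`. -/
noncomputable def errorEnergyDeriv (V : ∀ i, State (n i) → ℝ) (x x' : ∀ i, State (n i))
    (l l' z z' : Fin N → ℝ) : ℝ :=
  ∑ i, fderiv ℝ (V i) (x i) (x' i) + ∑ i, l i * l' i + ∑ i, z i * z' i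

theorem hasDerivWithinAt_half_sum_sq {l : Fin N → ℝ → ℝ} {l' : Fin N → ℝ} {s : Set ℝ} {t : ℝ}
    (hl : ∀ i, HasDerivWithinAt (l i) (l' i) s t) :
    HasDerivWithinAt (fun t => 1 / 2 * ∑ i, l i t ^ 2) (∑ i, l i t * l' i) s t := by
  refine ((HasDerivWithinAt.fun_sum fun i (_ : i ∈ Finset.univ) => (hl i).pow 2).const_mul
    (1 / 2)).congr_deriv ?_
  rw [Finset.mul_sum]
  exact Finset.sum_congr rfl fun i _ => by simp; ring

theorem hasDerivWithinAt_errorEnergy (hV : ∀ i, Differentiable ℝ (V i))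
    {x : ∀ i, ℝ → State (n i)} {l z : Fin N → ℝ → ℝ} {x' : ∀ i, State (n i)}
    {l' z' : Fin N → ℝ} {s : Set ℝ} {t : ℝ} (hx : ∀ i, HasDerivWithinAt (x i) (x' i) s t)
    (hl : ∀ i, HasDerivWithinAt (l i) (l' i) s t) (hz : ∀ i, HasDerivWithinAt (z i) (z' i) s t) :
    HasDerivWithinAt
      (fun t => errorEnergy V (fun i => x i t) (fun i => l i t) (fun i => z i t))
      (errorEnergyDeriv V (fun i => x i t) x' (fun i => l i t) l' (fun i => z i t) z') s t :=
  ((HasDerivWithinAt.fun_sum fun i _ =>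
    ((hV i (x i t)).hasFDerivAt.comp_hasDerivWithinAt t (hx i))).add
      (hasDerivWithinAt_half_sum_sq hl)).add (hasDerivWithinAt_half_sum_sq hz)

/-- Dissipation of the storage function along the closed loop. -/
theorem errorEnergyDeriv_le (ha : IsUndirectedWeights a)
    (hG : ∀ i, IsDissipativeAgent (G i) (h i) (xs i) (V i) c₁ c₂ c₃ κ)
    (x : ∀ i, State (n i)) (l z ε : Fin N → ℝ) :
    errorEnergyDeriv V x (fun i => G i (x i) (l i)) l
      (fun i => -relInfo a l i - relInfo a z i - (h i (x i) - h i (xs i)) - ε i) z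
      (fun i => relInfo a l i)
    ≤ -(c₃ * ∑ i, ‖x i - xs i‖ ^ 2) - lapForm a l - ∑ i, l i * ε i := by
  have h1 : ∑ i, fderiv ℝ (V i) (x i) (G i (x i) (l i))
      ≤ ∑ i, (-(c₃ * ‖x i - xs i‖ ^ 2) + (h i (x i) - h i (xs i)) * l i) :=
    Finset.sum_le_sum fun i _ => (hG i).dissip (x i) (l i)
  have h2 : ∑ i, l i * (-relInfo a l i - relInfo a z i - (h i (x i) - h i (xs i)) - ε i)
      = -lapForm a l - ∑ i, l i * relInfo a z i - ∑ i, (h i (x i) - h i (xs i)) * l i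
        - ∑ i, l i * ε i := by
    simp only [lapForm, ← Finset.sum_neg_distrib, ← Finset.sum_sub_distrib]
    exact Finset.sum_congr rfl fun i _ => by ring
  -- Self-adjointness cancels the coupling of `l` with `z`; the output term in the equation for `l`
  -- cancels the agents' supply.
  have h3 := ha.sum_mul_relInfo_comm l z
  rw [Finset.sum_add_distrib, Finset.sum_neg_distrib, ← Finset.mul_sum] at h1
  unfold errorEnergyDeriv
  linarith

theorem errorEnergy_nonneg (hc₁ : 0 ≤ c₁)
    (hG : ∀ i, IsDissipativeAgent (G i) (h i) (xs i) (V i) c₁ c₂ c₃ κ)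
    (x : ∀ i, State (n i)) (l z : Fin N → ℝ) :
    c₁ * ∑ i, ‖x i - xs i‖ ^ 2 + 1 / 2 * ∑ i, l i ^ 2 + 1 / 2 * ∑ i, z i ^ 2
      ≤ errorEnergy V x l z ∧ 0 ≤ errorEnergy V x l z := by
  have h1 : c₁ * ∑ i, ‖x i - xs i‖ ^ 2 ≤ ∑ i, V i (x i) := by
    rw [Finset.mul_sum]
    exact Finset.sum_le_sum fun i _ => (hG i).lower (x i)
  have h2 : 0 ≤ c₁ * ∑ i, ‖x i - xs i‖ ^ 2 :=
    mul_nonneg hc₁ (Finset.sum_nonneg fun i _ => sq_nonneg _)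
  have h3 : 0 ≤ ∑ i, l i ^ 2 := Finset.sum_nonneg fun i _ => sq_nonneg _
  have h4 : 0 ≤ ∑ i, z i ^ 2 := Finset.sum_nonneg fun i _ => sq_nonneg _
  constructor <;> unfold errorEnergy <;> linarith

/-- The states and multipliers stay bounded along error trajectories. -/
theorem IsErrorTrajectory.exists_bound (ha : IsUndirectedWeights a) (hc₁ : 0 < c₁) (hc₃ : 0 < c₃)
    (hG : ∀ i, IsDissipativeAgent (G i) (h i) (xs i) (V i) c₁ c₂ c₃ κ)
    {ε : Fin N → ℝ → ℝ} {x : ∀ i, ℝ → State (n i)} {l z : Fin N → ℝ → ℝ}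
    (hx : IsErrorTrajectory a G h xs ε x l z) {r K : ℝ} (hr : 0 < r) (hK : 0 ≤ K)
    (hε : ∀ t ≥ 0, ∀ i, |ε i t| ≤ K * Real.exp (-r * t)) :
    ∃ R : ℝ, ∀ t ≥ 0, ∀ i, ‖x i t - xs i‖ ≤ R ∧ |l i t| ≤ R := by
  have hd := fun t ht => hasDerivWithinAt_errorEnergy
    (fun i => (hG i).smooth_storage.differentiable one_ne_zero)
    (fun i => hx.agent i t ht) (fun i => hx.dual i t ht) (fun i => hx.aux i t ht)
  -- The driving term grows at most linearly in `l`, so it is bounded by an integrable multiple of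
  -- one plus the energy.
  obtain ⟨B, hB⟩ := exists_le_of_deriv_le_exp_mul (b := K * (N + 1)) hr (by positivity)
    (u := fun t => 1 + errorEnergy V (fun i => x i t) (fun i => l i t) (fun i => z i t))
    (fun t ht => (hd t ht).const_add 1)
    (fun t _ => by have := (errorEnergy_nonneg hc₁.le hG (fun i => x i t) (fun i => l i t)
                    (fun i => z i t)).2; linarith)
    (fun t ht => by
      have h1 := errorEnergyDeriv_le ha hG (fun i => x i t) (fun i => l i t) (fun i => z i t)
        (fun i => ε i t)
      obtain ⟨h2, h2'⟩ := errorEnergy_nonneg hc₁.le hG (fun i => x i t) (fun i => l i t)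
        (fun i => z i t)
      set E := errorEnergy V (fun i => x i t) (fun i => l i t) (fun i => z i t)
      set k := K * Real.exp (-r * t) with hk
      have hk0 : 0 ≤ k := by positivity
      have h3 := ha.lapForm_nonneg (fun i => l i t)
      have h4 : 0 ≤ ∑ i, ‖x i t - xs i‖ ^ 2 := Finset.sum_nonneg fun i _ => sq_nonneg _
      have h4' : 0 ≤ ∑ i, z i t ^ 2 := Finset.sum_nonneg fun i _ => sq_nonneg _
      have h5 : -∑ i, l i t * ε i t ≤ ∑ i, k * (1 / 2 + 1 / 2 * l i t ^ 2) := by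
        rw [← Finset.sum_neg_distrib]
        refine Finset.sum_le_sum fun i _ => ?_
        calc -(l i t * ε i t) ≤ |l i t * ε i t| := neg_le_abs _
          _ = |ε i t| * |l i t| := by rw [abs_mul, mul_comm]
          _ ≤ k * |l i t| := by gcongr; exact hε t ht i
          _ ≤ _ := by
            gcongr
            nlinarith [sq_nonneg (|l i t| - 1), sq_abs (l i t)]
      rw [← Finset.mul_sum, Finset.sum_add_distrib, ← Finset.mul_sum] at h5
      simp only [Finset.sum_const, Finset.card_univ, Fintype.card_fin, nsmul_eq_mul] at h5
      have hN : (0 : ℝ) ≤ N := Nat.cast_nonneg N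
      have h6 : k * (N * (1 / 2) + 1 / 2 * ∑ i, l i t ^ 2) ≤ k * ((N + 1) * (1 + E)) := by
        gcongr
        have := mul_nonneg hc₁.le h4
        nlinarith
      have h7 := mul_nonneg hc₃.le h4
      have h8 : K * (N + 1) * Real.exp (-r * t) * (1 + E) = k * ((N + 1) * (1 + E)) := by
        rw [hk]; ring
      rw [h8]
      linarith)
  have hB0 : 0 ≤ B := by
    have h1 := hB 0 le_rfl
    have h2 := (errorEnergy_nonneg hc₁.le hG (fun i => x i 0) (fun i => l i 0)
      (fun i => z i 0)).2
    linarith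
  refine ⟨√(B / c₁) + √(2 * B), fun t ht i => ?_⟩
  have h1 := hB t ht
  have h2 := (errorEnergy_nonneg hc₁.le hG (fun i => x i t) (fun i => l i t) (fun i => z i t)).1
  have hxi : ‖x i t - xs i‖ ^ 2 ≤ ∑ i, ‖x i t - xs i‖ ^ 2 :=
    Finset.single_le_sum (f := fun i => ‖x i t - xs i‖ ^ 2) (fun i _ => sq_nonneg _)
      (Finset.mem_univ i)
  have hli : l i t ^ 2 ≤ ∑ i, l i t ^ 2 :=
    Finset.single_le_sum (f := fun i => l i t ^ 2) (fun i _ => sq_nonneg _) (Finset.mem_univ i)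
  have hz0 : 0 ≤ ∑ i, z i t ^ 2 := Finset.sum_nonneg fun i _ => sq_nonneg _
  have hx0 : 0 ≤ c₁ * ‖x i t - xs i‖ ^ 2 := by positivity
  have hl0 := sq_nonneg (l i t)
  have hm := mul_le_mul_of_nonneg_left hxi hc₁.le
  constructor
  · refine le_add_of_le_of_nonneg (Real.le_sqrt_of_sq_le ?_) (Real.sqrt_nonneg _)
    rw [le_div_iff₀ hc₁]
    linarith
  · refine le_add_of_nonneg_of_le (Real.sqrt_nonneg _) (Real.abs_le_sqrt ?_)
    linarith

end ErrorSystem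

/-! ### Cross-term estimates and decay inside a ball -/

section ErrorRate

variable {N : ℕ} {n : Fin N → ℕ} {a : Matrix (Fin N) (Fin N) ℝ}
  {G : ∀ i, State (n i) → ℝ → State (n i)} {h : ∀ i, State (n i) → ℝ}
  {xs : ∀ i, State (n i)} {V : ∀ i, State (n i) → ℝ} {c₁ c₂ c₃ κ : ℝ}

/-- Derivative of `∑ l_i z_i`: the form of `z` appears with a negative sign, and half of it absorbs
the mixed term `z · relInfo l`. -/
theorem IsUndirectedWeights.cross_laplacian_le (ha : IsUndirectedWeights a)
    (l z y ε : Fin N → ℝ) :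
    ∑ i, ((-relInfo a l i - relInfo a z i - y i - ε i) * z i + l i * relInfo a l i)
      ≤ 3 / 2 * lapForm a l - 1 / 2 * lapForm a z - ∑ i, y i * z i - ∑ i, ε i * z i := by
  have h1 := ha.neg_two_mul_sum_mul_relInfo_le z l
  have h2 : ∑ i, ((-relInfo a l i - relInfo a z i - y i - ε i) * z i + l i * relInfo a l i)
      = -∑ i, z i * relInfo a l i - lapForm a z - ∑ i, y i * z i - ∑ i, ε i * z i
        + lapForm a l := by
    simp only [lapForm, ← Finset.sum_neg_distrib, ← Finset.sum_sub_distrib,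
      ← Finset.sum_add_distrib]
    exact Finset.sum_congr rfl fun i _ => by ring
  linarith

theorem abs_avg_le [NeZero N] {v : Fin N → ℝ} {b : ℝ} (hv : ∀ i, |v i| ≤ b) : |avg v| ≤ b := by
  have hN : (0 : ℝ) < N := Nat.cast_pos.2 (Nat.pos_of_ne_zero (NeZero.ne N))
  rw [avg, abs_div, abs_of_pos hN, div_le_iff₀ hN]
  calc |∑ i, v i| ≤ ∑ i, |v i| := Finset.abs_sum_le_sum_abs _ _
    _ ≤ ∑ _i : Fin N, b := Finset.sum_le_sum fun i _ => hv i
    _ = b * N := by simp [mul_comm]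

theorem abs_sum_mul_le {v w : Fin N → ℝ} {b c : ℝ} (hv : ∀ i, |v i| ≤ b)
    (hw : ∀ i, |w i| ≤ c) : |∑ i, v i * w i| ≤ N * (b * c) := by
  calc |∑ i, v i * w i| ≤ ∑ i, |v i * w i| := Finset.abs_sum_le_sum_abs _ _
    _ ≤ ∑ _i : Fin N, b * c := Finset.sum_le_sum fun i _ => by
      rw [abs_mul]
      exact mul_le_mul (hv i) (hw i) (abs_nonneg _) ((abs_nonneg _).trans (hv i))
    _ = _ := by simp

theorem abs_sum_mul_le_half (v w : Fin N → ℝ) :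
    |∑ i, v i * w i| ≤ 1 / 2 * ∑ i, v i ^ 2 + 1 / 2 * ∑ i, w i ^ 2 := by
  rw [Finset.mul_sum, Finset.mul_sum, ← Finset.sum_add_distrib]
  refine (Finset.abs_sum_le_sum_abs _ _).trans (Finset.sum_le_sum fun i _ => ?_)
  rw [abs_mul]
  nlinarith [sq_nonneg (|v i| - |w i|), sq_abs (v i), sq_abs (w i)]

/-- Derivative of the second cross term, with `Γ = G(x*, m)`, `g = G(x, l)`, `X = x - x*` and `m`
the mean of `l`. Since `g` differs from `Γ` by visible quantities, `-⟨Γ, g⟩` is at most `-‖Γ‖² / 2`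
plus visible terms, and `‖Γ‖ ≥ κ |m|`. -/
theorem neg_inner_add_inner_le {n : ℕ} {Γ Γ' g X : State n} {m m' d L κ P Q s e : ℝ}
    (hL : 0 ≤ L) (hκ : 0 ≤ κ) (hP : 0 ≤ P) (he : 0 ≤ e)
    (hg : ‖g - Γ‖ ≤ L * (‖X‖ + |d|)) (hΓ : κ * |m| ≤ ‖Γ‖) (hΓ' : ‖Γ'‖ ≤ L)
    (hm' : |m'| ≤ L * P + e) (hX : ‖X‖ ≤ P) (hd : d ^ 2 ≤ Q) (hXs : ‖X‖ ≤ s) :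
    -(inner ℝ Γ g + inner ℝ (m' • Γ') X)
      ≤ -(κ ^ 2 / 2) * m ^ 2 + 2 * L ^ 2 * (P ^ 2 + Q) + L * s * e := by
  have h1 : -inner ℝ Γ g ≤ -‖Γ‖ ^ 2 + ‖Γ‖ * (L * (‖X‖ + |d|)) := by
    have e1 : inner ℝ Γ g = inner ℝ Γ (g - Γ) + ‖Γ‖ ^ 2 := by
      rw [inner_sub_right, real_inner_self_eq_norm_sq]; ring
    have e2 := (abs_le.1 (abs_real_inner_le_norm Γ (g - Γ))).1
    have e3 := mul_le_mul_of_nonneg_left hg (norm_nonneg Γ)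
    linarith
  have h2 : -inner ℝ (m' • Γ') X ≤ (L * P + e) * L * ‖X‖ := by
    have e1 := (abs_le.1 (abs_real_inner_le_norm (m' • Γ') X)).1
    have e2 : ‖m' • Γ'‖ ≤ (L * P + e) * L := by
      rw [norm_smul, Real.norm_eq_abs]
      exact mul_le_mul hm' hΓ' (norm_nonneg _) (by positivity)
    have e3 := mul_le_mul_of_nonneg_right e2 (norm_nonneg X)
    linarith
  have h3 : κ ^ 2 * m ^ 2 ≤ ‖Γ‖ ^ 2 := by
    rw [← sq_abs m, ← mul_pow]
    exact pow_le_pow_left₀ (by positivity) hΓ 2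
  have h4 : ‖X‖ ^ 2 ≤ P ^ 2 := pow_le_pow_left₀ (norm_nonneg _) hX 2
  have h5 : ‖Γ‖ * (L * (‖X‖ + |d|)) ≤ 1 / 2 * ‖Γ‖ ^ 2 + L ^ 2 * (P ^ 2 + Q) := by
    have e1 : (‖X‖ + |d|) ^ 2 ≤ 2 * (P ^ 2 + Q) := by
      nlinarith [sq_nonneg (‖X‖ - |d|), sq_abs d]
    have e2 := mul_le_mul_of_nonneg_left e1 (sq_nonneg L)
    nlinarith [sq_nonneg (‖Γ‖ - L * (‖X‖ + |d|))]
  have h6 : (L * P + e) * L * ‖X‖ ≤ L ^ 2 * P ^ 2 + L * s * e := by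
    have e1 : P * ‖X‖ ≤ P ^ 2 := by rw [sq]; gcongr
    have e2 : L * e * ‖X‖ ≤ L * e * s := by gcongr
    nlinarith [mul_le_mul_of_nonneg_left e1 (sq_nonneg L)]
  have h7 : 0 ≤ L ^ 2 * Q := mul_nonneg (sq_nonneg L) ((sq_nonneg d).trans hd)
  nlinarith

/-- Squared distance of the visible variables to the equilibrium. -/
noncomputable def visibleSq (xs x : ∀ i, State (n i)) (l : Fin N → ℝ) : ℝ :=
  ∑ i, ‖x i - xs i‖ ^ 2 + ∑ i, (l i - avg l) ^ 2

/-- Squared distance of the hidden variables to the equilibrium. -/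
noncomputable def hiddenSq (l z : Fin N → ℝ) : ℝ := ∑ i, z i ^ 2 + avg l ^ 2

theorem visibleSq_nonneg (xs x : ∀ i, State (n i)) (l : Fin N → ℝ) : 0 ≤ visibleSq xs x l :=
  add_nonneg (Finset.sum_nonneg fun _ _ => sq_nonneg _) (Finset.sum_nonneg fun _ _ => sq_nonneg _)

theorem hiddenSq_nonneg (l z : Fin N → ℝ) : 0 ≤ hiddenSq l z :=
  add_nonneg (Finset.sum_nonneg fun _ _ => sq_nonneg _) (sq_nonneg _)

theorem norm_sub_sq_le_visibleSq (xs x : ∀ i, State (n i)) (l : Fin N → ℝ) (i : Fin N) :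
    ‖x i - xs i‖ ^ 2 ≤ visibleSq xs x l := by
  have h1 := Finset.single_le_sum (f := fun i => ‖x i - xs i‖ ^ 2)
    (fun i _ => sq_nonneg _) (Finset.mem_univ i)
  have h2 : 0 ≤ ∑ i, (l i - avg l) ^ 2 := Finset.sum_nonneg fun _ _ => sq_nonneg _
  unfold visibleSq
  linarith

theorem sub_avg_sq_le_visibleSq (xs x : ∀ i, State (n i)) (l : Fin N → ℝ) (i : Fin N) :
    (l i - avg l) ^ 2 ≤ visibleSq xs x l := by
  have h1 := Finset.single_le_sum (f := fun i => (l i - avg l) ^ 2)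
    (fun i _ => sq_nonneg _) (Finset.mem_univ i)
  have h2 : 0 ≤ ∑ i, ‖x i - xs i‖ ^ 2 := Finset.sum_nonneg fun _ _ => sq_nonneg _
  unfold visibleSq
  linarith

theorem abs_le_two_mul_sqrt (xs x : ∀ i, State (n i)) (l z : Fin N → ℝ) (i : Fin N) :
    |l i| ≤ 2 * √(visibleSq xs x l + hiddenSq l z) := by
  have h1 : |l i - avg l| ≤ √(visibleSq xs x l + hiddenSq l z) :=
    Real.abs_le_sqrt (by linarith [sub_avg_sq_le_visibleSq xs x l i, hiddenSq_nonneg l z])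
  have h2 : |avg l| ≤ √(visibleSq xs x l + hiddenSq l z) := by
    refine Real.abs_le_sqrt ?_
    have h3 : 0 ≤ ∑ i, z i ^ 2 := Finset.sum_nonneg fun _ _ => sq_nonneg _
    have h4 := visibleSq_nonneg xs x l
    unfold hiddenSq
    linarith
  calc |l i| = |(l i - avg l) + avg l| := by rw [sub_add_cancel]
    _ ≤ _ := (abs_add_le _ _).trans (by linarith)

/-- Supplies the comparison hypotheses of `exists_rate_of_cross_term`. The second cross term is
quadratic because `Γ` vanishes linearly in `avg l`. -/
theorem errorEnergy_bounds [NeZero N] (hc₁ : 0 ≤ c₁) (hc₂ : 0 ≤ c₂)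
    (hG : ∀ i, IsDissipativeAgent (G i) (h i) (xs i) (V i) c₁ c₂ c₃ κ)
    (x : ∀ i, State (n i)) (l z : Fin N → ℝ) {L C : ℝ} (hL : 0 ≤ L) (i₀ : Fin N)
    {Γ : State (n i₀)} (hΓ : ‖Γ‖ ≤ L * |avg l|) (hC : c₂ + N + L + 1 ≤ C) :
    min c₁ (1 / 2) * (visibleSq xs x l + hiddenSq l z) ≤ errorEnergy V x l z ∧
      errorEnergy V x l z ≤ C * (visibleSq xs x l + hiddenSq l z) ∧
      |∑ i, l i * z i - inner ℝ Γ (x i₀ - xs i₀)| ≤ C * (visibleSq xs x l + hiddenSq l z) := by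
  have hN : (1 : ℝ) ≤ N := Nat.one_le_cast.2 (Nat.pos_of_ne_zero (NeZero.ne N))
  have hpos := (errorEnergy_nonneg hc₁ hG x l z).1
  have hsum := sum_sq_eq_add_avg l
  have hV : ∑ i, V i (x i) ≤ c₂ * ∑ i, ‖x i - xs i‖ ^ 2 := by
    rw [Finset.mul_sum]
    exact Finset.sum_le_sum fun i _ => (hG i).upper (x i)
  have hlz := abs_sum_mul_le_half l z
  have hin : |inner ℝ Γ (x i₀ - xs i₀)|
      ≤ L / 2 * avg l ^ 2 + L / 2 * ∑ i, ‖x i - xs i‖ ^ 2 := by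
    have h1 := Finset.single_le_sum (f := fun i => ‖x i - xs i‖ ^ 2)
      (fun i _ => sq_nonneg _) (Finset.mem_univ i₀)
    have h2 := abs_real_inner_le_norm Γ (x i₀ - xs i₀)
    have h3 := mul_le_mul_of_nonneg_right hΓ (norm_nonneg (x i₀ - xs i₀))
    have h4 : |avg l| * ‖x i₀ - xs i₀‖
        ≤ 1 / 2 * avg l ^ 2 + 1 / 2 * ∑ i, ‖x i - xs i‖ ^ 2 := by
      have := sq_nonneg (|avg l| - ‖x i₀ - xs i₀‖)
      have := sq_abs (avg l)
      linarith
    have h5 := mul_le_mul_of_nonneg_left h4 hL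
    linarith
  have hin' := abs_sub (∑ i, l i * z i) (inner ℝ Γ (x i₀ - xs i₀))
  have hp0 : 0 ≤ ∑ i, ‖x i - xs i‖ ^ 2 := Finset.sum_nonneg fun _ _ => sq_nonneg _
  have hq0 : 0 ≤ ∑ i, (l i - avg l) ^ 2 := Finset.sum_nonneg fun _ _ => sq_nonneg _
  have hz0 : 0 ≤ ∑ i, z i ^ 2 := Finset.sum_nonneg fun _ _ => sq_nonneg _
  have hm0 := sq_nonneg (avg l)
  simp only [visibleSq, hiddenSq, errorEnergy] at hpos ⊢
  generalize ∑ i, ‖x i - xs i‖ ^ 2 = p at *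
  generalize ∑ i, (l i - avg l) ^ 2 = q at *
  generalize ∑ i, z i ^ 2 = ζ at *
  generalize avg l = m at *
  have hNm : m ^ 2 ≤ N * m ^ 2 := le_mul_of_one_le_left hm0 hN
  have e1 := mul_le_mul_of_nonneg_right (min_le_left c₁ (1 / 2)) hp0
  have e2 := mul_le_mul_of_nonneg_right (min_le_right c₁ (1 / 2))
    (add_nonneg (add_nonneg hq0 hz0) hm0)
  have f1 : (c₂ + L / 2) * p ≤ C * p := by gcongr; linarith
  have f2 : 1 / 2 * q ≤ C * q := by gcongr; linarith
  have f3 : 1 / 2 * ζ ≤ C * ζ := by gcongr; linarith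
  have f4 : (N / 2 + L / 2) * m ^ 2 ≤ C * m ^ 2 := by gcongr; linarith
  have f5 : 0 ≤ L * p := by positivity
  have f6 : 0 ≤ L * m ^ 2 := by positivity
  have f7 : 0 ≤ c₂ * p := by positivity
  refine ⟨?_, ?_, ?_⟩
  · linarith
  · linarith
  · linarith

/-- The Poincaré inequality turns the Laplacian form of `l` into control of `l - avg l`; together
with the agents' dissipation this is exactly the visible part. -/
theorem errorEnergyDeriv_le_visibleSq (ha : IsUndirectedWeights a)
    (hG : ∀ i, IsDissipativeAgent (G i) (h i) (xs i) (V i) c₁ c₂ c₃ κ)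
    (x : ∀ i, State (n i)) (l z ε : Fin N → ℝ) {Kp ca C e : ℝ} (hKp : 0 < Kp)
    (hpoin : ∑ i, (l i - avg l) ^ 2 ≤ Kp * lapForm a l) (hca1 : ca ≤ c₃) (hca2 : ca ≤ 1 / Kp)
    (he : 0 ≤ e) (hε : ∀ i, |ε i| ≤ e) (hC : 2 * N ≤ C) :
    errorEnergyDeriv V x (fun i => G i (x i) (l i)) l
      (fun i => -relInfo a l i - relInfo a z i - (h i (x i) - h i (xs i)) - ε i) z
      (fun i => relInfo a l i)
    ≤ -ca * visibleSq xs x l + C * √(visibleSq xs x l + hiddenSq l z) * e := by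
  have h1 := errorEnergyDeriv_le ha hG x l z ε
  have h2 := (abs_le.1 (abs_sum_mul_le (fun i => abs_le_two_mul_sqrt xs x l z i) hε)).1
  have hp0 : 0 ≤ ∑ i, ‖x i - xs i‖ ^ 2 := Finset.sum_nonneg fun _ _ => sq_nonneg _
  have hq0 : 0 ≤ ∑ i, (l i - avg l) ^ 2 := Finset.sum_nonneg fun _ _ => sq_nonneg _
  have h4 : ca * ∑ i, (l i - avg l) ^ 2 ≤ lapForm a l := by
    calc _ ≤ 1 / Kp * ∑ i, (l i - avg l) ^ 2 := by gcongr
      _ ≤ 1 / Kp * (Kp * lapForm a l) := by gcongr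
      _ = _ := by field_simp
  have h5 := mul_le_mul_of_nonneg_right hca1 hp0
  have h6 : 2 * N * (√(visibleSq xs x l + hiddenSq l z) * e)
      ≤ C * (√(visibleSq xs x l + hiddenSq l z) * e) := by gcongr
  have h7 : -ca * visibleSq xs x l
      = -(ca * ∑ i, ‖x i - xs i‖ ^ 2) - ca * ∑ i, (l i - avg l) ^ 2 := by
    unfold visibleSq; ring
  rw [h7]
  linarith

/-- The cross term dissipates the hidden part. Coercivity in `z` uses zero mean, coercivity in `avg
l` uses the input bound `κ`, and the mean of `l'` is visible up to `e` because the Laplacian terms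
sum to zero. -/
theorem cross_term_deriv_le (ha : IsUndirectedWeights a) (x : ∀ i, State (n i))
    (l z y ε : Fin N → ℝ) [NeZero N] {Kp Kq L ca C e : ℝ} (hKp : 0 < Kp) (hKq : 0 ≤ Kq)
    (hL : 0 ≤ L) (hκ : 0 ≤ κ) (he : 0 ≤ e)
    (hpoin : ∑ i, (z i - avg z) ^ 2 ≤ Kp * lapForm a z) (hz : ∑ i, z i = 0)
    (hup : lapForm a l ≤ Kq * ∑ i, (l i - avg l) ^ 2)
    (hca3 : ca ≤ 1 / (4 * Kp)) (hca4 : ca ≤ κ ^ 2 / 2)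
    (hC : N + L + 3 / 2 * Kq + Kp * L ^ 2 + 2 * L ^ 2 ≤ C)
    (hY : ∀ i, |y i| ≤ L * ‖x i - xs i‖) (hε : ∀ i, |ε i| ≤ e) (i₀ : Fin N)
    {Γ Γ' g : State (n i₀)} (hg : ‖g - Γ‖ ≤ L * (‖x i₀ - xs i₀‖ + |l i₀ - avg l|))
    (hΓ : κ * |avg l| ≤ ‖Γ‖) (hΓ' : ‖Γ'‖ ≤ L) :
    ∑ i, ((-relInfo a l i - relInfo a z i - y i - ε i) * z i + l i * relInfo a l i)
      - (inner ℝ Γ g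
        + inner ℝ ((avg fun i => -relInfo a l i - relInfo a z i - y i - ε i) • Γ') (x i₀ - xs i₀))
    ≤ -ca * hiddenSq l z + C * visibleSq xs x l
      + C * √(visibleSq xs x l + hiddenSq l z) * e := by
  set P := √(∑ i, ‖x i - xs i‖ ^ 2) with hP
  have hp0 : 0 ≤ ∑ i, ‖x i - xs i‖ ^ 2 := Finset.sum_nonneg fun _ _ => sq_nonneg _
  have hP2 : P ^ 2 = ∑ i, ‖x i - xs i‖ ^ 2 := Real.sq_sqrt hp0
  have hq0 : 0 ≤ ∑ i, (l i - avg l) ^ 2 := Finset.sum_nonneg fun _ _ => sq_nonneg _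
  have hz0 : 0 ≤ ∑ i, z i ^ 2 := Finset.sum_nonneg fun _ _ => sq_nonneg _
  have hXP : ∀ i, ‖x i - xs i‖ ≤ P := fun i => Real.le_sqrt_of_sq_le
    (Finset.single_le_sum (f := fun i => ‖x i - xs i‖ ^ 2) (fun i _ => sq_nonneg _)
      (Finset.mem_univ i))
  have hzs : ∀ i, |z i| ≤ √(visibleSq xs x l + hiddenSq l z) := fun i => Real.abs_le_sqrt (by
    have h1 := Finset.single_le_sum (f := fun i => z i ^ 2) (fun i _ => sq_nonneg _)
      (Finset.mem_univ i)
    have h2 := visibleSq_nonneg xs x l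
    have h3 := sq_nonneg (avg l)
    unfold hiddenSq
    linarith)
  have hm' : |avg fun i => -relInfo a l i - relInfo a z i - y i - ε i| ≤ L * P + e := by
    have h1 : (avg fun i => -relInfo a l i - relInfo a z i - y i - ε i)
        = avg fun i => -y i - ε i := by
      simp only [avg, Finset.sum_sub_distrib, Finset.sum_neg_distrib, ha.sum_relInfo]
      ring
    rw [h1]
    refine abs_avg_le fun i => ?_
    refine (abs_sub _ _).trans (add_le_add ?_ (hε i))
    rw [abs_neg]
    exact (hY i).trans (mul_le_mul_of_nonneg_left (hXP i) hL)
  have hXs : ‖x i₀ - xs i₀‖ ≤ √(visibleSq xs x l + hiddenSq l z) :=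
    Real.le_sqrt_of_sq_le (by
      linarith [hiddenSq_nonneg l z, norm_sub_sq_le_visibleSq xs x l i₀])
  have hs0 : 0 ≤ √(visibleSq xs x l + hiddenSq l z) := Real.sqrt_nonneg _
  have hB := neg_inner_add_inner_le (Q := ∑ i, (l i - avg l) ^ 2) hL hκ (Real.sqrt_nonneg _) he
    hg hΓ hΓ' hm' (hXP i₀)
    (Finset.single_le_sum (f := fun i => (l i - avg l) ^ 2)
      (fun i _ => sq_nonneg _) (Finset.mem_univ i₀)) hXs
  rw [hP2] at hB
  have hA := ha.cross_laplacian_le l z y ε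
  have hεz := (abs_le.1 (abs_sum_mul_le hε hzs)).1
  have hYz : -∑ i, y i * z i
      ≤ Kp * L ^ 2 * ∑ i, ‖x i - xs i‖ ^ 2 + 1 / (4 * Kp) * ∑ i, z i ^ 2 := by
    rw [← Finset.sum_neg_distrib, Finset.mul_sum, Finset.mul_sum, ← Finset.sum_add_distrib]
    refine Finset.sum_le_sum fun i _ => ?_
    have h1 : -(y i * z i) ≤ L * ‖x i - xs i‖ * |z i| := by
      refine (neg_le_abs _).trans ?_
      rw [abs_mul]
      exact mul_le_mul_of_nonneg_right (hY i) (abs_nonneg _)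
    have h2 : 0 ≤ Kp * (L * ‖x i - xs i‖ - |z i| / (2 * Kp)) ^ 2 := by positivity
    have h3 : Kp * (L * ‖x i - xs i‖ - |z i| / (2 * Kp)) ^ 2
        = Kp * L ^ 2 * ‖x i - xs i‖ ^ 2 + 1 / (4 * Kp) * z i ^ 2
          - L * ‖x i - xs i‖ * |z i| := by
      rw [← sq_abs (z i)]
      field_simp
      ring
    linarith
  -- The form of `z` is split in two equal shares: one absorbs the Young term of `y · z`, the other
  -- is the dissipation kept.
  have hzz : 1 / (4 * Kp) * ∑ i, z i ^ 2 + 1 / (4 * Kp) * ∑ i, z i ^ 2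
      ≤ 1 / 2 * lapForm a z := by
    have h2 : avg z = 0 := by simp [avg, hz]
    simp only [h2, sub_zero] at hpoin
    calc _ = 1 / (2 * Kp) * ∑ i, z i ^ 2 := by field_simp; ring
      _ ≤ 1 / (2 * Kp) * (Kp * lapForm a z) := by gcongr
      _ = _ := by field_simp
  have g1 := mul_le_mul_of_nonneg_right hca3 hz0
  have g2 := mul_le_mul_of_nonneg_right hca4 (sq_nonneg (avg l))
  have hKL : 0 ≤ Kp * L ^ 2 := by positivity
  have hL2 : 0 ≤ L ^ 2 := sq_nonneg L
  have hN : (0 : ℝ) ≤ N := Nat.cast_nonneg N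
  have g3 : (Kp * L ^ 2 + 2 * L ^ 2) * ∑ i, ‖x i - xs i‖ ^ 2
      ≤ C * ∑ i, ‖x i - xs i‖ ^ 2 := by gcongr; linarith
  have g4 : (3 / 2 * Kq + 2 * L ^ 2) * ∑ i, (l i - avg l) ^ 2
      ≤ C * ∑ i, (l i - avg l) ^ 2 := by gcongr; linarith
  have g5 : (N + L) * (√(visibleSq xs x l + hiddenSq l z) * e)
      ≤ C * (√(visibleSq xs x l + hiddenSq l z) * e) := by gcongr; linarith
  have g6 : -ca * hiddenSq l z + C * visibleSq xs x l
      + C * √(visibleSq xs x l + hiddenSq l z) * e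
      = -(ca * ∑ i, z i ^ 2) - ca * avg l ^ 2
        + C * ∑ i, ‖x i - xs i‖ ^ 2 + C * ∑ i, (l i - avg l) ^ 2
        + C * (√(visibleSq xs x l + hiddenSq l z) * e) := by
    unfold visibleSq hiddenSq; ring
  rw [g6]
  linarith

/-- As long as an error trajectory stays in a fixed ball, it decays at a fixed rate. -/
theorem exists_rate_errorTrajectory (ha : IsUndirectedWeights a)
    (hconn : (weightGraph a).Connected) (hc₁ : 0 < c₁) (hc₂ : 0 < c₂) (hc₃ : 0 < c₃) (hκ : 0 < κ)
    (hG : ∀ i, IsDissipativeAgent (G i) (h i) (xs i) (V i) c₁ c₂ c₃ κ) (R : ℝ) {r : ℝ}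
    (hr : 0 < r) :
    ∃ ρ > 0, ∀ (ε : Fin N → ℝ → ℝ) (x : ∀ i, ℝ → State (n i)) (l z : Fin N → ℝ → ℝ) (T K : ℝ),
      IsErrorTrajectory a G h xs ε x l z → 0 ≤ T → 0 ≤ K →
      (∀ t ≥ 0, ∀ i, |ε i t| ≤ K * Real.exp (-r * t)) → (∀ t ≥ 0, ∑ i, z i t = 0) →
      (∀ t ≥ T, ∀ i, ‖x i t - xs i‖ ≤ R ∧ |l i t| ≤ R) →
      ∃ K' : ℝ, ∀ t ≥ T, visibleSq xs (fun i => x i t) (fun i => l i t)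
        + hiddenSq (fun i => l i t) (fun i => z i t) ≤ K' * Real.exp (-ρ * t) := by
  obtain ⟨i₀⟩ := hconn.nonempty
  have : NeZero N := ⟨fun h0 => by subst h0; exact i₀.elim0⟩
  have hN : (1 : ℝ) ≤ N := Nat.one_le_cast.2 (Nat.pos_of_ne_zero (NeZero.ne N))
  obtain ⟨Kp, hKp, hpoin⟩ := ha.exists_sum_sq_sub_avg_le hconn
  obtain ⟨Kq, hKq, hup⟩ := ha.exists_lapForm_le
  choose ℓ hℓ0 hℓ₁ hℓ₂ hℓ₃ using fun i => (hG i).exists_lipschitz R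
  obtain ⟨L, hL, hℓL⟩ := exists_pos_forall_ge ℓ
  set ca : ℝ := min (min c₃ (1 / Kp)) (min (1 / (4 * Kp)) (κ ^ 2 / 2)) with hca
  have hca0 : 0 < ca := by positivity
  have hca1 : ca ≤ c₃ := (min_le_left _ _).trans (min_le_left _ _)
  have hca2 : ca ≤ 1 / Kp := (min_le_left _ _).trans (min_le_right _ _)
  have hca3 : ca ≤ 1 / (4 * Kp) := (min_le_right _ _).trans (min_le_left _ _)
  have hca4 : ca ≤ κ ^ 2 / 2 := (min_le_right _ _).trans (min_le_right _ _)
  set C : ℝ := c₂ + 2 * N + 1 + L + 3 / 2 * Kq + Kp * L ^ 2 + 2 * L ^ 2 with hC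
  have hKpL : 0 < Kp * L ^ 2 := by positivity
  have hL2 : 0 < L ^ 2 := by positivity
  have hC0 : 0 < C := by positivity
  obtain ⟨ρ, hρ, hmain⟩ := exists_rate_of_cross_term hca0
    (lt_min hc₁ (by norm_num : (0:ℝ) < 1 / 2)) hC0 hr
  refine ⟨ρ, hρ, fun ε x l z T K htr hT hK hε hz hR => ?_⟩
  set l' : Fin N → ℝ → ℝ := fun i t => -relInfo a (fun j => l j t) i - relInfo a (fun j => z j t) i
    - (h i (x i t) - h i (xs i)) - ε i t with hl'
  have hdE := fun t ht => hasDerivWithinAt_errorEnergy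
    (fun i => (hG i).smooth_storage.differentiable one_ne_zero)
    (fun i => htr.agent i t ht) (fun i => htr.dual i t ht) (fun i => htr.aux i t ht)
  have hdavg : ∀ t ≥ 0, HasDerivWithinAt (fun t => avg fun i => l i t) (avg fun i => l' i t)
      (Ici 0) t := fun t ht =>
    (HasDerivWithinAt.fun_sum fun i _ => htr.dual i t ht).div_const _
  have hsm : ContDiff ℝ 1 (G i₀ (xs i₀)) := (hG i₀).smooth_field.comp
    (contDiff_const.prodMk contDiff_id : ContDiff ℝ 1 fun v : ℝ => (xs i₀, v))
  have hdΓ : ∀ t ≥ 0, HasDerivWithinAt (fun t => G i₀ (xs i₀) (avg fun i => l i t))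
      ((avg fun i => l' i t) • deriv (G i₀ (xs i₀)) (avg fun i => l i t)) (Ici 0) t :=
    fun t ht => ((hsm.differentiable one_ne_zero _).hasDerivAt).scomp_hasDerivWithinAt t
      (hdavg t ht)
  -- A single agent `i₀` suffices for the second term, as `avg l` is one scalar.
  have hdA : ∀ t ≥ 0, HasDerivWithinAt (fun t => ∑ i, l i t * z i t
      - inner ℝ (G i₀ (xs i₀) (avg fun i => l i t)) (x i₀ t - xs i₀))
      (∑ i, (l' i t * z i t + l i t * relInfo a (fun j => l j t) i)
        - (inner ℝ (G i₀ (xs i₀) (avg fun i => l i t)) (G i₀ (x i₀ t) (l i₀ t))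
          + inner ℝ ((avg fun i => l' i t) • deriv (G i₀ (xs i₀)) (avg fun i => l i t))
            (x i₀ t - xs i₀))) (Ici 0) t := fun t ht =>
    (HasDerivWithinAt.fun_sum fun i _ => (htr.dual i t ht).mul (htr.aux i t ht)).sub
      ((hdΓ t ht).inner ℝ ((htr.agent i₀ t ht).sub_const _))
  refine hmain _ _ _ _ (fun t => visibleSq xs (fun i => x i t) (fun i => l i t))
    (fun t => hiddenSq (fun i => l i t) (fun i => z i t)) (fun t => K * Real.exp (-r * t)) T K hT
    hdE hdA (fun t _ => ⟨visibleSq_nonneg _ _ _, hiddenSq_nonneg _ _⟩) ?_ ?_ ?_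
    (fun t _ => ⟨by positivity, le_rfl⟩)
  · intro t ht
    have hR0 : 0 ≤ R := (abs_nonneg _).trans (hR t ht i₀).2
    refine errorEnergy_bounds hc₁.le hc₂.le hG (fun i => x i t) (fun i => l i t)
      (fun i => z i t) hL.le i₀ ?_ (by rw [hC]; linarith)
    have := hℓ₁ i₀ (xs i₀) (avg fun i => l i t) 0 (by simpa using hR0)
      (abs_avg_le fun i => (hR t ht i).2) (by simpa using hR0)
    rw [(hG i₀).steady] at this
    simp only [sub_zero, sub_self, norm_zero, zero_add] at this
    exact this.trans (mul_le_mul_of_nonneg_right (hℓL i₀) (abs_nonneg _))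
  · intro t ht
    exact errorEnergyDeriv_le_visibleSq ha hG (fun i => x i t) (fun i => l i t)
      (fun i => z i t) (fun i => ε i t) hKp (hpoin _) hca1 hca2 (by positivity)
      (hε t (hT.trans ht)) (by rw [hC]; linarith)
  · intro t ht
    exact cross_term_deriv_le ha (fun i => x i t) (fun i => l i t) (fun i => z i t)
      (fun i => h i (x i t) - h i (xs i)) (fun i => ε i t) hKp hKq.le hL.le hκ.le (by positivity)
      (hpoin _) (hz t (hT.trans ht)) (hup _ _) hca3 hca4 (by rw [hC]; linarith)
      (fun i => (hℓ₂ i _ (hR t ht i).1).trans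
        (mul_le_mul_of_nonneg_right (hℓL i) (norm_nonneg _)))
      (hε t (hT.trans ht)) i₀
      ((hℓ₁ i₀ _ _ _ (hR t ht i₀).1 (hR t ht i₀).2 (abs_avg_le fun i => (hR t ht i).2)).trans
        (mul_le_mul_of_nonneg_right (hℓL i₀) (by positivity)))
      ((hG i₀).input _) ((hℓ₃ i₀ _ (abs_avg_le fun i => (hR t ht i).2)).trans (hℓL i₀))

end ErrorRate

/-! ### Exponential convergence of the error system -/

theorem tendsto_mul_exp_neg_mul {ρ : ℝ} (hρ : 0 < ρ) (K : ℝ) :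
    Tendsto (fun t : ℝ => K * Real.exp (-ρ * t)) atTop (𝓝 0) := by
  have h1 : Tendsto (fun t : ℝ => -ρ * t) atTop atBot :=
    tendsto_id.const_mul_atTop_of_neg (neg_lt_zero.2 hρ)
  simpa using (Real.tendsto_exp_atBot.comp h1).const_mul K

/-- The outputs of the error system converge at a rate that does not depend on the trajectory. -/
theorem exists_output_rate {N : ℕ} {n : Fin N → ℕ} {a : Matrix (Fin N) (Fin N) ℝ}
    {G : ∀ i, State (n i) → ℝ → State (n i)} {h : ∀ i, State (n i) → ℝ}
    {xs : ∀ i, State (n i)} {V : ∀ i, State (n i) → ℝ} {c₁ c₂ c₃ κ : ℝ}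
    (ha : IsUndirectedWeights a) (hconn : (weightGraph a).Connected)
    (hc₁ : 0 < c₁) (hc₂ : 0 < c₂) (hc₃ : 0 < c₃) (hκ : 0 < κ)
    (hG : ∀ i, IsDissipativeAgent (G i) (h i) (xs i) (V i) c₁ c₂ c₃ κ) {r : ℝ} (hr : 0 < r) :
    ∃ ρ > 0, ∀ (ε : Fin N → ℝ → ℝ) (x : ∀ i, ℝ → State (n i)) (l z : Fin N → ℝ → ℝ) (K : ℝ),
      IsErrorTrajectory a G h xs ε x l z → 0 ≤ K →
      (∀ t ≥ 0, ∀ i, |ε i t| ≤ K * Real.exp (-r * t)) → (∀ t ≥ 0, ∑ i, z i t = 0) →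
      (∃ R : ℝ, ∀ t ≥ 0, ∀ i, ‖x i t - xs i‖ ≤ R) ∧
      ∃ C : ℝ, ∀ i, ∀ t ≥ 0, |h i (x i t) - h i (xs i)| ≤ C * Real.exp (-ρ * t) := by
  -- The rate of the unit ball is fixed before any trajectory is given. The trajectory-dependent
  -- rate `ρ'` below only serves to reach that ball.
  obtain ⟨ρ, hρ, hlocal⟩ := exists_rate_errorTrajectory ha hconn hc₁ hc₂ hc₃ hκ hG 1 hr
  -- Halved because `ρ` is the rate of a squared distance.
  refine ⟨ρ / 2, half_pos hρ, fun ε x l z K htr hK hε hz => ?_⟩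
  obtain ⟨R, hR⟩ := htr.exists_bound ha hc₁ hc₃ hG hr hK hε
  refine ⟨⟨R, fun t ht i => (hR t ht i).1⟩, ?_⟩
  obtain ⟨ρ', hρ', hglobal⟩ := exists_rate_errorTrajectory ha hconn hc₁ hc₂ hc₃ hκ hG R hr
  obtain ⟨K₁, hK₁⟩ := hglobal ε x l z 0 K htr le_rfl hK hε hz hR
  -- The threshold `1 / 4` gives `√(P + H) ≤ 1 / 2`, and `|l i| ≤ 2 √(P + H)`.
  obtain ⟨T, hT0, hT⟩ : ∃ T : ℝ, 0 ≤ T ∧ ∀ t ≥ T, K₁ * Real.exp (-ρ' * t) ≤ 1 / 4 := by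
    have h1 := (tendsto_mul_exp_neg_mul hρ' K₁).eventually_le_const
      (by norm_num : (0 : ℝ) < 1 / 4)
    obtain ⟨T, hT⟩ := (h1.and (eventually_ge_atTop 0)).exists_forall_of_atTop
    exact ⟨T, (hT T le_rfl).2, fun t ht => (hT t ht).1⟩
  have hsmall : ∀ t ≥ T, ∀ i, ‖x i t - xs i‖ ≤ 1 ∧ |l i t| ≤ 1 := fun t ht i => by
    have h1 := (hK₁ t (hT0.trans ht)).trans (hT t ht)
    have h2 := Real.sqrt_le_sqrt h1
    rw [show (1 / 4 : ℝ) = (1 / 2) ^ 2 by norm_num, Real.sqrt_sq (by norm_num)] at h2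
    have h3 := abs_le_two_mul_sqrt xs (fun i => x i t) (fun i => l i t) (fun i => z i t) i
    have h4 := norm_sub_sq_le_visibleSq xs (fun i => x i t) (fun i => l i t) i
    have h5 := hiddenSq_nonneg (fun i => l i t) (fun i => z i t)
    exact ⟨by nlinarith [norm_nonneg (x i t - xs i)], by linarith⟩
  obtain ⟨K₂, hK₂⟩ := hlocal ε x l z T K htr hT0 hK hε hz hsmall
  choose ℓ hℓ0 _ hℓ _ using fun i => (hG i).exists_lipschitz R
  obtain ⟨L, hL, hℓL⟩ := exists_pos_forall_ge ℓ
  have hY : ∀ t ≥ 0, ∀ i, |h i (x i t) - h i (xs i)| ≤ L * ‖x i t - xs i‖ := fun t ht i =>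
    (hℓ i _ (hR t ht i).1).trans (mul_le_mul_of_nonneg_right (hℓL i) (norm_nonneg _))
  refine ⟨L * (√K₂ + |R| * Real.exp (ρ / 2 * T)), fun i t ht => (hY t ht i).trans ?_⟩
  rw [mul_assoc]
  refine mul_le_mul_of_nonneg_left ?_ hL.le
  rw [add_mul]
  have hexp := Real.exp_pos (-(ρ / 2) * t)
  rcases le_total T t with hTt | hTt
  · refine le_add_of_le_of_nonneg ?_ (by positivity)
    have h1 := (norm_sub_sq_le_visibleSq xs (fun i => x i t) (fun i => l i t) i)
    have h2 := hiddenSq_nonneg (fun i => l i t) (fun i => z i t)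
    have h3 : ‖x i t - xs i‖ ^ 2 ≤ K₂ * Real.exp (-(ρ / 2) * t) ^ 2 := by
      have : Real.exp (-(ρ / 2) * t) ^ 2 = Real.exp (-ρ * t) := by
        rw [sq, ← Real.exp_add]; ring_nf
      rw [this]
      linarith [hK₂ t hTt]
    have h4 := Real.le_sqrt_of_sq_le h3
    rwa [Real.sqrt_mul' _ (sq_nonneg _), Real.sqrt_sq hexp.le] at h4
  · refine le_add_of_nonneg_of_le (by positivity) ?_
    rw [mul_assoc, ← Real.exp_add]
    have h1 : 1 ≤ Real.exp (ρ / 2 * T + -(ρ / 2) * t) := Real.one_le_exp (by nlinarith)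
    exact ((hR t ht i).1.trans (le_abs_self R)).trans
      (le_mul_of_one_le_right (abs_nonneg R) h1)

/-! ### Exponentially passive agents under the output feedback -/

theorem IsDissipativeAgent.mono {n : ℕ} {G : State n → ℝ → State n} {h : State n → ℝ}
    {xs : State n} {V : State n → ℝ} {c₁ c₂ c₃ κ c₁' c₂' c₃' κ' : ℝ}
    (hG : IsDissipativeAgent G h xs V c₁ c₂ c₃ κ) (h₁ : c₁' ≤ c₁) (h₂ : c₂ ≤ c₂') (h₃ : c₃' ≤ c₃)
    (h₄ : κ' ≤ κ) : IsDissipativeAgent G h xs V c₁' c₂' c₃' κ' where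
  smooth_field := hG.smooth_field
  smooth_output := hG.smooth_output
  smooth_storage := hG.smooth_storage
  lower x := le_trans (by gcongr) (hG.lower x)
  upper x := (hG.upper x).trans (by gcongr)
  dissip x v := (hG.dissip x v).trans (by gcongr)
  steady := hG.steady
  input v := le_trans (by gcongr) (hG.input v)

/-- The agent dynamics under the output feedback, as a function of the multiplier error `v`. -/
noncomputable def feedbackField {n : ℕ} (γ : ℝ) (g : State n → ℝ → State n) (h : State n → ℝ)
    (f ur : ℝ → ℝ) (ys : ℝ) (x : State n) (v : ℝ) : State n :=
  g x (-γ * deriv f (h x) + (v + γ * deriv f ys) + ur (h x))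

/-- The function `f' - lo * s` is monotone because its derivative is `f'' - lo ≥ 0`. -/
theorem IsCost.mul_sq_le {lo : ℝ} {f : ℝ → ℝ} (hf : IsCost lo f) (x y : ℝ) :
    lo * (x - y) ^ 2 ≤ (x - y) * (deriv f x - deriv f y) := by
  have hd : Differentiable ℝ (deriv f) :=
    (hf.smooth.differentiable_deriv_two)
  have hmono : Monotone fun s => deriv f s - lo * s := by
    refine monotone_of_deriv_nonneg (hd.sub (differentiable_id.const_mul lo)) fun s => ?_
    have := ((hd s).hasDerivAt.sub ((hasDerivAt_id s).const_mul lo)).deriv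
    simp only [id_eq, mul_one] at this
    rw [show (fun s => deriv f s - lo * s) = (deriv f - fun y => lo * y) from rfl, this]
    linarith [hf.lower s]
  rcases le_total x y with hxy | hxy
  · have := hmono hxy
    simp only at this
    nlinarith
  · have := hmono hxy
    simp only at this
    nlinarith

/-- The feedback adds `-γ (f'(y) - f'(y*)) + ur(y) - ur(y*)` to the input error. Paired with `y -
y*` this is at most `(M - γ lo) (y - y*)² ≤ 0`, so only the supply by `v` remains, with the same
`V`. -/
theorem exists_isDissipativeAgent {n : ℕ} {g : State n → ℝ → State n} {h : State n → ℝ}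
    {f : ℝ → ℝ} {xr : ℝ → State n} {ur : ℝ → ℝ} {M : ℝ≥0} {lo γ ys : ℝ}
    (hg : ContDiff ℝ ∞ (fun p : State n × ℝ => g p.1 p.2)) (hh : ContDiff ℝ ∞ h)
    (hf : IsCost lo f) (hr : IsRegulator g h xr ur) (hM : LipschitzWith M ur)
    (hp : IsExpPassiveAt g h (xr ys) (ur ys)) (hγ0 : 0 ≤ γ) (hγ : M ≤ γ * lo) :
    ∃ (V : State n → ℝ) (c₁ c₂ c₃ κ : ℝ), 0 < c₁ ∧ 0 < c₂ ∧ 0 < c₃ ∧ 0 < κ ∧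
      IsDissipativeAgent (feedbackField γ g h f ur ys) h (xr ys) V c₁ c₂ c₃ κ := by
  have hgc : ∀ u, Continuous fun x => g x u := fun u =>
    hg.continuous.comp (by fun_prop : Continuous fun x : State n => (x, u))
  obtain ⟨κ, hκ, hin⟩ := hp.exists_le_norm hgc (hh.of_le (by simp)) hr hM
  obtain ⟨c₁, c₂, c₃, V, hc₁, hc₂, hc₃, hV, hVb, hd⟩ := hp
  refine ⟨V, c₁, c₂, c₃, κ, hc₁, hc₂, hc₃, hκ, ?_⟩
  have hf' : ContDiff ℝ 1 (deriv f) := by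
    have h2 := hf.smooth
    rw [← one_add_one_eq_two, contDiff_succ_iff_deriv] at h2
    exact h2.2.2
  have hh1 : ContDiff ℝ 1 h := hh.of_le (by simp)
  have hu1 : ContDiff ℝ 1 ur := hr.smooth_u.of_le (by simp)
  have hg1 : ContDiff ℝ 1 (fun p : State n × ℝ => g p.1 p.2) := hg.of_le (by simp)
  refine ⟨?_, hh1, hV, fun x => (hVb x).1, fun x => (hVb x).2, fun x v => ?_, ?_, fun v => ?_⟩
  · have h1 : ContDiff ℝ 1 fun p : State n × ℝ => (p.1,
        -γ * deriv f (h p.1) + (p.2 + γ * deriv f ys) + ur (h p.1)) := by fun_prop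
    exact hg1.comp h1
  · refine (hd x _).trans (add_le_add le_rfl ?_)
    rw [hr.output]
    have h1 := hf.mul_sq_le (h x) ys
    have h2 : (h x - ys) * (ur (h x) - ur ys) ≤ M * (h x - ys) ^ 2 := by
      have := hM.dist_le_mul (h x) ys
      rw [Real.dist_eq, Real.dist_eq] at this
      calc _ ≤ |(h x - ys) * (ur (h x) - ur ys)| := le_abs_self _
        _ = |h x - ys| * |ur (h x) - ur ys| := abs_mul _ _
        _ ≤ |h x - ys| * (M * |h x - ys|) := by gcongr
        _ = M * |h x - ys| ^ 2 := by ring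
        _ = _ := by rw [sq_abs]
    have h3 := mul_le_mul_of_nonneg_left h1 hγ0
    have h4 := mul_le_mul_of_nonneg_right hγ (sq_nonneg (h x - ys))
    nlinarith
  · simp only [feedbackField, hr.output]
    convert hr.steady ys using 2
    ring
  · have := hin (ur ys + v)
    simp only [feedbackField, hr.output]
    rw [add_sub_cancel_left] at this
    convert this using 3
    ring

/-! ### The exosystem and the observer error -/

/-- The state of the exosystem that generates the observation. -/
noncomputable def exoState {k : ℕ} (d0 : ℝ) (w A φ : Fin k → ℝ) (t : ℝ) : ObsIdx k → ℝ :=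
  Sum.elim (fun _ => d0) fun p =>
    if p.1 = 0 then A p.2 * Real.sin (w p.2 * t + φ p.2) else A p.2 * Real.cos (w p.2 * t + φ p.2)

theorem obsRow_dotProduct_exoState {k : ℕ} (d0 : ℝ) (w A φ : Fin k → ℝ) (t : ℝ) :
    obsRow k ⬝ᵥ exoState d0 w A φ t = observation d0 w A φ t := by
  simp [dotProduct, obsRow, exoState, observation, Fintype.sum_prod_type]

theorem distRow_dotProduct_exoState {k : ℕ} (d0 : ℝ) (w A φ : Fin k → ℝ) (t : ℝ) :
    distRow k ⬝ᵥ exoState d0 w A φ t = observation d0 w A φ t - d0 := by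
  simp [dotProduct, distRow, exoState, observation, Fintype.sum_prod_type]

theorem hasDerivAt_exoState {k : ℕ} (d0 : ℝ) (w A φ : Fin k → ℝ) (t : ℝ) :
    HasDerivAt (exoState d0 w A φ) ((exoMatrix w).mulVec (exoState d0 w A φ t)) t := by
  rw [hasDerivAt_pi]
  have hlin : ∀ j, HasDerivAt (fun t => w j * t + φ j) (w j) t := fun j => by
    simpa using ((hasDerivAt_id t).const_mul (w j)).add_const (φ j)
  rintro (u | ⟨b, j⟩)
  · have h0 : (exoMatrix w).mulVec (exoState d0 w A φ t) (Sum.inl u) = 0 := by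
      simp [exoMatrix, Matrix.mulVec, dotProduct]
    rw [h0]
    exact hasDerivAt_const t d0
  · have h0 : (exoMatrix w).mulVec (exoState d0 w A φ t) (Sum.inr (b, j))
        = !![0, w j; -w j, 0] b 0 * (A j * Real.sin (w j * t + φ j))
          + !![0, w j; -w j, 0] b 1 * (A j * Real.cos (w j * t + φ j)) := by
      simp [exoMatrix, Matrix.mulVec, dotProduct, exoState, Fintype.sum_prod_type,
        Matrix.blockDiagonal_apply, Fin.sum_univ_two]
    rw [h0]
    fin_cases b
    · refine ((hlin j).sin.const_mul (A j)).congr_deriv ?_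
      simp
      ring
    · refine ((hlin j).cos.const_mul (A j)).congr_deriv ?_
      simp
      ring

theorem observerMatrix_mulVec {k : ℕ} (w : Fin k → ℝ) (L : ObsIdx k → ℝ) (v : ObsIdx k → ℝ) :
    (observerMatrix w L).mulVec v = (exoMatrix w).mulVec v - (obsRow k ⬝ᵥ v) • L := by
  rw [observerMatrix, Matrix.sub_mulVec, Matrix.vecMulVec_mulVec]
  ext i
  simp [mul_comm]

/-- The exosystem state is itself a solution of the observer equation, as `obsRow` reads off the
observation; the difference is therefore autonomous. -/
theorem hasDerivWithinAt_observer_error {k : ℕ} {d0 : ℝ} {w A φ : Fin k → ℝ} {L : ObsIdx k → ℝ}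
    {η : ℝ → ObsIdx k → ℝ} {s : Set ℝ} {t : ℝ}
    (hη : HasDerivWithinAt η ((observerMatrix w L).mulVec (η t)
      + observation d0 w A φ t • L) s t) :
    HasDerivWithinAt (fun t => η t - exoState d0 w A φ t)
      ((observerMatrix w L).mulVec (η t - exoState d0 w A φ t)) s t := by
  refine (hη.sub (hasDerivAt_exoState d0 w A φ t).hasDerivWithinAt).congr_deriv ?_
  rw [Matrix.mulVec_sub, observerMatrix_mulVec w L (exoState d0 w A φ t),
    obsRow_dotProduct_exoState]
  abel

theorem hasDerivWithinAt_observer {k : ℕ} {d0 : ℝ} {w A φ : Fin k → ℝ} {L : ObsIdx k → ℝ}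
    {e : ℝ → ObsIdx k → ℝ} {s : Set ℝ} {t : ℝ}
    (he : HasDerivWithinAt e ((observerMatrix w L).mulVec (e t)) s t) :
    HasDerivWithinAt (fun t => e t + exoState d0 w A φ t)
      ((observerMatrix w L).mulVec (e t + exoState d0 w A φ t)
        + observation d0 w A φ t • L) s t := by
  refine (he.add (hasDerivAt_exoState d0 w A φ t).hasDerivWithinAt).congr_deriv ?_
  rw [Matrix.mulVec_add, observerMatrix_mulVec w L (exoState d0 w A φ t),
    obsRow_dotProduct_exoState]
  abel

/-! ### Existence of error trajectories -/

theorem exists_dotProduct_mulVec_le {ι : Type*} [Fintype ι] (M : Matrix ι ι ℝ) :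
    ∃ K > 0, ∀ v : ι → ℝ, ∑ i, v i * M.mulVec v i ≤ K * ∑ i, v i ^ 2 := by
  refine ⟨∑ i, ∑ j, |M i j| + 1, by positivity, fun v => ?_⟩
  have hv : ∀ i, v i ^ 2 ≤ ∑ i, v i ^ 2 := fun i =>
    Finset.single_le_sum (f := fun i => v i ^ 2) (fun _ _ => sq_nonneg _) (Finset.mem_univ i)
  have h0 : 0 ≤ ∑ i, v i ^ 2 := Finset.sum_nonneg fun _ _ => sq_nonneg _
  have h1 : ∑ i, v i * M.mulVec v i ≤ ∑ i, ∑ j, |M i j| * ∑ i, v i ^ 2 := by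
    refine Finset.sum_le_sum fun i _ => ?_
    simp only [Matrix.mulVec, dotProduct]
    rw [Finset.mul_sum]
    refine Finset.sum_le_sum fun j _ => ?_
    calc v i * (M i j * v j) ≤ |v i * (M i j * v j)| := le_abs_self _
      _ = |M i j| * (|v i| * |v j|) := by rw [abs_mul, abs_mul]; ring
      _ ≤ _ := by
        gcongr
        nlinarith [hv i, hv j, sq_nonneg (|v i| - |v j|), sq_abs (v i), sq_abs (v j)]
  simp only [← Finset.sum_mul] at h1
  linarith

theorem HasDerivWithinAt.prod_fst {E F : Type*} [NormedAddCommGroup E] [NormedSpace ℝ E]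
    [NormedAddCommGroup F] [NormedSpace ℝ F] {α : ℝ → E × F} {α' : E × F} {s : Set ℝ} {t : ℝ}
    (h : HasDerivWithinAt α α' s t) : HasDerivWithinAt (fun t => (α t).1) α'.1 s t :=
  (ContinuousLinearMap.fst ℝ E F).hasFDerivAt.comp_hasDerivWithinAt t h

theorem HasDerivWithinAt.prod_snd {E F : Type*} [NormedAddCommGroup E] [NormedSpace ℝ E]
    [NormedAddCommGroup F] [NormedSpace ℝ F] {α : ℝ → E × F} {α' : E × F} {s : Set ℝ} {t : ℝ}
    (h : HasDerivWithinAt α α' s t) : HasDerivWithinAt (fun t => (α t).2) α'.2 s t :=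
  (ContinuousLinearMap.snd ℝ E F).hasFDerivAt.comp_hasDerivWithinAt t h

section Existence

variable {N : ℕ} {n : Fin N → ℕ} {k : Fin N → ℕ} {a : Matrix (Fin N) (Fin N) ℝ}
  {G : ∀ i, State (n i) → ℝ → State (n i)} {h : ∀ i, State (n i) → ℝ}
  {xs : ∀ i, State (n i)} {V : ∀ i, State (n i) → ℝ} {c₁ c₂ c₃ κ : ℝ}

/-- State space of the closed loop: agents, multipliers, observer errors and auxiliary states. -/
abbrev LoopState (n k : Fin N → ℕ) : Type :=
  (∀ i, State (n i)) × (Fin N → ℝ) × (∀ i, ObsIdx (k i) → ℝ) × (Fin N → ℝ)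

/-- The closed loop in error coordinates as an autonomous vector field. -/
noncomputable def loopField (a : Matrix (Fin N) (Fin N) ℝ)
    (G : ∀ i, State (n i) → ℝ → State (n i)) (h : ∀ i, State (n i) → ℝ)
    (xs : ∀ i, State (n i)) (w : ∀ i, Fin (k i) → ℝ) (L : ∀ i, ObsIdx (k i) → ℝ)
    (p : LoopState n k) : LoopState n k :=
  (fun i => G i (p.1 i) (p.2.1 i),
    fun i => -relInfo a p.2.1 i - relInfo a p.2.2.2 i - (h i (p.1 i) - h i (xs i))
      - distRow (k i) ⬝ᵥ p.2.2.1 i,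
    fun i => (observerMatrix (w i) (L i)).mulVec (p.2.2.1 i),
    fun i => relInfo a p.2.1 i)

/-- The storage function of the closed loop together with the observer errors. -/
noncomputable def loopEnergy (V : ∀ i, State (n i) → ℝ) (p : LoopState n k) : ℝ :=
  errorEnergy V p.1 p.2.1 p.2.2.2 + 1 / 2 * ∑ i, ∑ j, p.2.2.1 i j ^ 2

theorem contDiff_loopField (hG : ∀ i, IsDissipativeAgent (G i) (h i) (xs i) (V i) c₁ c₂ c₃ κ)
    (w : ∀ i, Fin (k i) → ℝ) (L : ∀ i, ObsIdx (k i) → ℝ) :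
    ContDiff ℝ 1 (loopField a G h xs w L) := by
  have h1 : ∀ i, ContDiff ℝ 1 fun p : LoopState n k => p.1 i := contDiff_pi.1 contDiff_fst
  have h2 : ∀ i, ContDiff ℝ 1 fun p : LoopState n k => p.2.1 i := fun i => by fun_prop
  have h3 : ∀ i, ContDiff ℝ 1 fun p : LoopState n k => p.2.2.2 i := fun i => by fun_prop
  have h4 : ∀ i j, ContDiff ℝ 1 fun p : LoopState n k => p.2.2.1 i j := fun i =>
    contDiff_pi.1 (contDiff_pi.1 (contDiff_fst.comp (contDiff_snd.comp contDiff_snd)) i)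
  refine ContDiff.prodMk (contDiff_pi.2 fun i => ?_) (ContDiff.prodMk (contDiff_pi.2 fun i => ?_)
    (ContDiff.prodMk (contDiff_pi.2 fun i => contDiff_pi.2 fun j => ?_)
      (contDiff_pi.2 fun i => ?_)))
  · exact (hG i).smooth_field.comp ((h1 i).prodMk (h2 i))
  · have h5 := (hG i).smooth_output.comp (h1 i)
    simp only [relInfo, dotProduct]
    refine ((ContDiff.sub ?_ ?_).sub (h5.sub contDiff_const)).sub ?_
    · exact (ContDiff.sum fun j _ => contDiff_const.mul ((h2 i).sub (h2 j))).neg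
    · exact ContDiff.sum fun j _ => contDiff_const.mul ((h3 i).sub (h3 j))
    · exact ContDiff.sum fun j _ => contDiff_const.mul (h4 i j)
  · simp only [Matrix.mulVec, dotProduct]
    exact ContDiff.sum fun j' _ => contDiff_const.mul (h4 i j')
  · simp only [relInfo]
    exact ContDiff.sum fun j _ => contDiff_const.mul ((h2 i).sub (h2 j))

theorem differentiable_loopEnergy
    (hG : ∀ i, IsDissipativeAgent (G i) (h i) (xs i) (V i) c₁ c₂ c₃ κ) :
    Differentiable ℝ (loopEnergy V : LoopState n k → ℝ) := by
  have h1 : ∀ i, Differentiable ℝ fun p : LoopState n k => V i (p.1 i) := fun i =>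
    ((hG i).smooth_storage.differentiable one_ne_zero).comp (differentiable_pi.1 differentiable_fst i)
  have h2 : ∀ i j, Differentiable ℝ fun p : LoopState n k => p.2.2.1 i j := fun i =>
    differentiable_pi.1 (differentiable_pi.1
      (differentiable_fst.comp (differentiable_snd.comp differentiable_snd)) i)
  unfold loopEnergy errorEnergy
  refine (((Differentiable.fun_sum fun i _ => h1 i).add ?_).add ?_).add
    ((Differentiable.fun_sum fun i _ => Differentiable.fun_sum fun j _ => (h2 i j).pow 2).const_mul _)
  · fun_prop
  · fun_prop

/-- Only growth matters for existence: `l · ε` and the quadratic form of the observer matrices are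
bounded by multiples of the energy. -/
theorem fderiv_loopEnergy_le (ha : IsUndirectedWeights a) (hc₁ : 0 < c₁) (hc₃ : 0 < c₃)
    (hG : ∀ i, IsDissipativeAgent (G i) (h i) (xs i) (V i) c₁ c₂ c₃ κ)
    (w : ∀ i, Fin (k i) → ℝ) (L : ∀ i, ObsIdx (k i) → ℝ) :
    ∃ K : ℝ, 0 ≤ K ∧ ∀ p, fderiv ℝ (loopEnergy V) p (loopField a G h xs w L p)
      ≤ K * loopEnergy V p := by
  choose K hK0 hK using fun i => exists_dotProduct_mulVec_le (observerMatrix (w i) (L i))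
  obtain ⟨B, hB, hKB⟩ := exists_pos_forall_ge K
  obtain ⟨D, hD, hDD⟩ := exists_pos_forall_ge fun i => ∑ j, distRow (k i) j ^ 2
  refine ⟨1 + 2 * B + D, by positivity, fun p => ?_⟩
  obtain ⟨x, l, e, z⟩ := p
  set F := loopField a G h xs w L (x, l, e, z) with hF
  -- The differential is computed along a straight line, so that the derivative formula for curves
  -- applies.
  have hcurve : HasDerivAt (fun s : ℝ => loopEnergy V ((x, l, e, z) + s • F))
      (fderiv ℝ (loopEnergy V) (x, l, e, z) F) 0 := by
    have h1 : HasDerivAt (fun s : ℝ => (x, l, e, z) + s • F) F 0 := by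
      simpa using ((hasDerivAt_id (0 : ℝ)).smul_const F).const_add (x, l, e, z)
    have h2 : HasFDerivAt (loopEnergy V) (fderiv ℝ (loopEnergy V) (x, l, e, z))
        ((x, l, e, z) + (0 : ℝ) • F) := by
      simpa using (differentiable_loopEnergy hG (x, l, e, z)).hasFDerivAt
    exact h2.comp_hasDerivAt 0 h1
  have hline : ∀ {W : Type} [NormedAddCommGroup W] [NormedSpace ℝ W] (u v : W),
      HasDerivWithinAt (fun s : ℝ => u + s • v) v univ 0 := fun u v => by
    have h1 : HasDerivAt (fun s : ℝ => u + s • v) v 0 := by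
      simpa using ((hasDerivAt_id (0 : ℝ)).smul_const v).const_add u
    exact h1.hasDerivWithinAt
  have hformula := (hasDerivWithinAt_errorEnergy (V := V) (t := 0) (s := univ)
    (fun i => (hG i).smooth_storage.differentiable one_ne_zero)
    (x := fun i s => x i + s • F.1 i) (l := fun i s => l i + s • F.2.1 i)
    (z := fun i s => z i + s • F.2.2.2 i)
    (fun i => hline _ _) (fun i => hline _ _) (fun i => hline _ _)).add
    ((HasDerivWithinAt.fun_sum fun i (_ : i ∈ Finset.univ) => HasDerivWithinAt.fun_sum
      fun j (_ : j ∈ Finset.univ) => (hline (e i j) (F.2.2.1 i j)).pow 2).const_mul (1 / 2))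
  have heq := hcurve.unique (hformula.hasDerivAt univ_mem)
  rw [heq]
  simp only [zero_smul, add_zero]
  have h1 := errorEnergyDeriv_le ha hG x l z (fun i => distRow (k i) ⬝ᵥ e i)
  have h2 := (errorEnergy_nonneg hc₁.le hG x l z)
  have h3 := ha.lapForm_nonneg l
  have h4 : 0 ≤ ∑ i, ‖x i - xs i‖ ^ 2 := Finset.sum_nonneg fun i _ => sq_nonneg _
  have h4' : 0 ≤ ∑ i, z i ^ 2 := Finset.sum_nonneg fun i _ => sq_nonneg _
  have h5 := (abs_le.1 (abs_sum_mul_le_half l (fun i => distRow (k i) ⬝ᵥ e i))).1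
  have h6 : ∑ i, (distRow (k i) ⬝ᵥ e i) ^ 2 ≤ D * ∑ i, ∑ j, e i j ^ 2 := by
    rw [Finset.mul_sum]
    refine Finset.sum_le_sum fun i _ => ?_
    calc (distRow (k i) ⬝ᵥ e i) ^ 2 ≤ (∑ j, distRow (k i) j ^ 2) * ∑ j, e i j ^ 2 :=
          Finset.sum_mul_sq_le_sq_mul_sq _ _ _
      _ ≤ _ := by gcongr; exact hDD i
  have h7 : ∑ i, ∑ j, e i j * (observerMatrix (w i) (L i)).mulVec (e i) j
      ≤ B * ∑ i, ∑ j, e i j ^ 2 := by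
    rw [Finset.mul_sum]
    exact Finset.sum_le_sum fun i _ => (hK i (e i)).trans (by gcongr; exact hKB i)
  have h8 : 1 / 2 * ∑ i, ∑ j, (2 : ℕ) * e i j ^ (2 - 1) * F.2.2.1 i j
      = ∑ i, ∑ j, e i j * (observerMatrix (w i) (L i)).mulVec (e i) j := by
    simp only [Finset.mul_sum]
    refine Finset.sum_congr rfl fun i _ => Finset.sum_congr rfl fun j _ => ?_
    simp only [hF, loopField]
    push_cast
    ring
  rw [h8]
  have h9 : 0 ≤ ∑ i, ∑ j, e i j ^ 2 :=
    Finset.sum_nonneg fun i _ => Finset.sum_nonneg fun j _ => sq_nonneg _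
  have h10 : loopEnergy V (x, l, e, z) = errorEnergy V x l z + 1 / 2 * ∑ i, ∑ j, e i j ^ 2 := rfl
  have h11 : errorEnergyDeriv V x F.1 l F.2.1 z F.2.2.2
      ≤ -(c₃ * ∑ i, ‖x i - xs i‖ ^ 2) - lapForm a l - ∑ i, l i * (distRow (k i) ⬝ᵥ e i) := h1
  rw [h10]
  have h12 := mul_nonneg hc₁.le h4
  have h13 := mul_nonneg hc₃.le h4
  have h14 : 0 ≤ (2 * B + D) * errorEnergy V x l z := mul_nonneg (by positivity) h2.2
  have h15 := h2.1
  linarith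

theorem coercive_loopEnergy (hc₁ : 0 < c₁)
    (hG : ∀ i, IsDissipativeAgent (G i) (h i) (xs i) (V i) c₁ c₂ c₃ κ) (b : ℝ) :
    ∃ R, ∀ p : LoopState n k, loopEnergy V p ≤ b → ‖p‖ ≤ R := by
  refine ⟨√(b / c₁) + ∑ i, ‖xs i‖ + √(2 * b), fun p hp => ?_⟩
  obtain ⟨x, l, e, z⟩ := p
  have hpos := (errorEnergy_nonneg hc₁.le hG x l z).1
  have hb : errorEnergy V x l z + 1 / 2 * ∑ i, ∑ j, e i j ^ 2 ≤ b := hp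
  have hx0 : 0 ≤ ∑ i, ‖x i - xs i‖ ^ 2 := Finset.sum_nonneg fun i _ => sq_nonneg _
  have hx1 := mul_nonneg hc₁.le hx0
  have hl0 : 0 ≤ ∑ i, l i ^ 2 := Finset.sum_nonneg fun i _ => sq_nonneg _
  have hz0 : 0 ≤ ∑ i, z i ^ 2 := Finset.sum_nonneg fun i _ => sq_nonneg _
  have he0 : 0 ≤ ∑ i, ∑ j, e i j ^ 2 :=
    Finset.sum_nonneg fun i _ => Finset.sum_nonneg fun j _ => sq_nonneg _
  have hs0 : 0 ≤ ∑ i, ‖xs i‖ := Finset.sum_nonneg fun i _ => norm_nonneg _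
  have hr1 := Real.sqrt_nonneg (b / c₁)
  have hr2 := Real.sqrt_nonneg (2 * b)
  have hR : 0 ≤ √(b / c₁) + ∑ i, ‖xs i‖ + √(2 * b) := by positivity
  have hreal : ∀ s : ℝ, s ^ 2 ≤ 2 * b → ‖s‖ ≤ √(b / c₁) + ∑ i, ‖xs i‖ + √(2 * b) := fun s hs => by
    rw [Real.norm_eq_abs]
    linarith [Real.abs_le_sqrt hs]
  simp only [Prod.norm_def]
  refine max_le ?_ (max_le ?_ (max_le ?_ ?_))
  · refine (pi_norm_le_iff_of_nonneg hR).2 fun i => ?_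
    have h1 := Finset.single_le_sum (f := fun i => ‖x i - xs i‖ ^ 2) (fun i _ => sq_nonneg _)
      (Finset.mem_univ i)
    have h2 : ‖x i - xs i‖ ≤ √(b / c₁) := by
      refine Real.le_sqrt_of_sq_le ?_
      rw [le_div_iff₀ hc₁]
      have := mul_le_mul_of_nonneg_left h1 hc₁.le
      linarith
    have h3 := Finset.single_le_sum (f := fun i => ‖xs i‖) (fun i _ => norm_nonneg _)
      (Finset.mem_univ i)
    have h4 : ‖x i‖ ≤ ‖x i - xs i‖ + ‖xs i‖ := by
      simpa using norm_add_le (x i - xs i) (xs i)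
    linarith
  · refine (pi_norm_le_iff_of_nonneg hR).2 fun i => hreal _ ?_
    have h1 := Finset.single_le_sum (f := fun i => l i ^ 2) (fun i _ => sq_nonneg _)
      (Finset.mem_univ i)
    linarith
  · refine (pi_norm_le_iff_of_nonneg hR).2 fun i =>
      (pi_norm_le_iff_of_nonneg hR).2 fun j => hreal _ ?_
    have h1 := Finset.single_le_sum (f := fun j => e i j ^ 2) (fun i _ => sq_nonneg _)
      (Finset.mem_univ j)
    have h2 := Finset.single_le_sum (f := fun i => ∑ j, e i j ^ 2)
      (fun i _ => Finset.sum_nonneg fun j _ => sq_nonneg _) (Finset.mem_univ i)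
    linarith
  · refine (pi_norm_le_iff_of_nonneg hR).2 fun i => hreal _ ?_
    have h1 := Finset.single_le_sum (f := fun i => z i ^ 2) (fun i _ => sq_nonneg _)
      (Finset.mem_univ i)
    linarith

/-- Error trajectories exist for all initial values. -/
theorem exists_errorTrajectory (ha : IsUndirectedWeights a) (hc₁ : 0 < c₁) (hc₃ : 0 < c₃)
    (hG : ∀ i, IsDissipativeAgent (G i) (h i) (xs i) (V i) c₁ c₂ c₃ κ)
    (w : ∀ i, Fin (k i) → ℝ) (L : ∀ i, ObsIdx (k i) → ℝ) (x₀ : ∀ i, State (n i))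
    (l₀ : Fin N → ℝ) (e₀ : ∀ i, ObsIdx (k i) → ℝ) (z₀ : Fin N → ℝ) :
    ∃ (x : ∀ i, ℝ → State (n i)) (l : Fin N → ℝ → ℝ) (e : ∀ i, ℝ → ObsIdx (k i) → ℝ)
      (z : Fin N → ℝ → ℝ),
      IsErrorTrajectory a G h xs (fun i t => distRow (k i) ⬝ᵥ e i t) x l z ∧
      (∀ i, ∀ t ≥ 0, HasDerivWithinAt (e i) ((observerMatrix (w i) (L i)).mulVec (e i t))
        (Ici 0) t) ∧
      ∀ i, x i 0 = x₀ i ∧ l i 0 = l₀ i ∧ e i 0 = e₀ i ∧ z i 0 = z₀ i := by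
  obtain ⟨K, hK, hKW⟩ := fderiv_loopEnergy_le ha hc₁ hc₃ hG w L
  obtain ⟨α, hα0, hα⟩ := exists_solution_of_lyapunov (contDiff_loopField (a := a) hG w L)
    (differentiable_loopEnergy hG) (fun p => add_nonneg
      (errorEnergy_nonneg hc₁.le hG p.1 p.2.1 p.2.2.2).2 (mul_nonneg (by norm_num)
        (Finset.sum_nonneg fun i _ => Finset.sum_nonneg fun j _ => sq_nonneg _))) hK hKW
    (coercive_loopEnergy hc₁ hG) (x₀, l₀, e₀, z₀)
  have hfst : ∀ t ≥ 0, HasDerivWithinAt (fun t => (α t).1)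
      (loopField a G h xs w L (α t)).1 (Ici 0) t := fun t ht =>
    (hα t ht).prod_fst
  have hsnd : ∀ t ≥ 0, HasDerivWithinAt (fun t => (α t).2)
      (loopField a G h xs w L (α t)).2 (Ici 0) t := fun t ht =>
    (hα t ht).prod_snd
  have hl : ∀ t ≥ 0, HasDerivWithinAt (fun t => (α t).2.1)
      (loopField a G h xs w L (α t)).2.1 (Ici 0) t := fun t ht =>
    (hsnd t ht).prod_fst
  have hez : ∀ t ≥ 0, HasDerivWithinAt (fun t => (α t).2.2)
      (loopField a G h xs w L (α t)).2.2 (Ici 0) t := fun t ht =>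
    (hsnd t ht).prod_snd
  have he : ∀ t ≥ 0, HasDerivWithinAt (fun t => (α t).2.2.1)
      (loopField a G h xs w L (α t)).2.2.1 (Ici 0) t := fun t ht =>
    (hez t ht).prod_fst
  have hz : ∀ t ≥ 0, HasDerivWithinAt (fun t => (α t).2.2.2)
      (loopField a G h xs w L (α t)).2.2.2 (Ici 0) t := fun t ht =>
    (hez t ht).prod_snd
  refine ⟨fun i t => (α t).1 i, fun i t => (α t).2.1 i, fun i t => (α t).2.2.1 i,
    fun i t => (α t).2.2.2 i, ⟨fun i t ht => ?_, fun i t ht => ?_, fun i t ht => ?_⟩,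
    fun i t ht => ?_, fun i => by simp [hα0]⟩
  · exact hasDerivWithinAt_pi.1 (hfst t ht) i
  · exact hasDerivWithinAt_pi.1 (hl t ht) i
  · exact hasDerivWithinAt_pi.1 (hz t ht) i
  · exact hasDerivWithinAt_pi.1 (he t ht) i

end Existence

/-! ### From the closed loop to error coordinates and back -/

section Conversion

variable {N : ℕ} {n k : Fin N → ℕ} {a : Matrix (Fin N) (Fin N) ℝ} {w : ∀ i, Fin (k i) → ℝ}
  {L : ∀ i, ObsIdx (k i) → ℝ} {γ : ℝ} {g : ∀ i, State (n i) → ℝ → State (n i)}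
  {h : ∀ i, State (n i) → ℝ} {f : Fin N → ℝ → ℝ} {ur : Fin N → ℝ → ℝ} {d0 ys : Fin N → ℝ}
  {A φ : ∀ i, Fin (k i) → ℝ} {xs : ∀ i, State (n i)} {μ : ℝ} {zs : Fin N → ℝ}

/-- Since `distRow` applied to the exosystem state is `d - d⁰`, the input `d - D^ε η` equals `d⁰ -
ε`, and `relInfo a zs` cancels the constant `d⁰ - y*`. -/
theorem IsClosedLoopTrajectory.isErrorTrajectory (hxs : ∀ i, h i (xs i) = ys i)
    (hμ : ∀ i, γ * deriv (f i) (ys i) = μ) (hzs : ∀ i, relInfo a zs i = d0 i - ys i)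
    {x : ∀ i, ℝ → State (n i)} {lam : Fin N → ℝ → ℝ} {η : ∀ i, ℝ → ObsIdx (k i) → ℝ}
    {z : Fin N → ℝ → ℝ}
    (htr : IsClosedLoopTrajectory a w L γ g h f ur
      (fun i => observation (d0 i) (w i) (A i) (φ i)) x lam η z) :
    IsErrorTrajectory a (fun i => feedbackField γ (g i) (h i) (f i) (ur i) (ys i)) h xs
      (fun i t => distRow (k i) ⬝ᵥ (η i t - exoState (d0 i) (w i) (A i) (φ i) t)) x
      (fun i t => lam i t - μ) (fun i t => z i t - zs i) where
  agent i t ht := by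
    refine (htr.agent i t ht).congr_deriv ?_
    simp only [feedbackField, hμ, sub_add_cancel]
  dual i t ht := by
    refine ((htr.dual i t ht).sub_const μ).congr_deriv ?_
    have h1 := relInfo_sub a (fun j => lam j t) (fun _ => μ) i
    have h2 := relInfo_sub a (fun j => z j t) zs i
    rw [relInfo_const] at h1
    rw [hzs] at h2
    rw [h1, h2, hxs, dotProduct_sub, distRow_dotProduct_exoState]
    ring
  aux i t ht := by
    refine ((htr.aux i t ht).sub_const (zs i)).congr_deriv ?_
    have h1 := relInfo_sub a (fun j => lam j t) (fun _ => μ) i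
    rw [relInfo_const] at h1
    rw [h1, sub_zero]

theorem IsErrorTrajectory.isClosedLoopTrajectory (hxs : ∀ i, h i (xs i) = ys i)
    (hμ : ∀ i, γ * deriv (f i) (ys i) = μ) (hzs : ∀ i, relInfo a zs i = d0 i - ys i)
    {x : ∀ i, ℝ → State (n i)} {l : Fin N → ℝ → ℝ} {e : ∀ i, ℝ → ObsIdx (k i) → ℝ}
    {z : Fin N → ℝ → ℝ}
    (htr : IsErrorTrajectory a (fun i => feedbackField γ (g i) (h i) (f i) (ur i) (ys i)) h xs
      (fun i t => distRow (k i) ⬝ᵥ e i t) x l z)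
    (he : ∀ i, ∀ t ≥ 0, HasDerivWithinAt (e i) ((observerMatrix (w i) (L i)).mulVec (e i t))
      (Ici 0) t) :
    IsClosedLoopTrajectory a w L γ g h f ur (fun i => observation (d0 i) (w i) (A i) (φ i)) x
      (fun i t => l i t + μ) (fun i t => e i t + exoState (d0 i) (w i) (A i) (φ i) t)
      (fun i t => z i t + zs i) where
  agent i t ht := by
    refine (htr.agent i t ht).congr_deriv ?_
    simp only [feedbackField, hμ]
  dual i t ht := by
    refine ((htr.dual i t ht).add_const μ).congr_deriv ?_
    have h1 := relInfo_add a (fun j => l j t) (fun _ => μ) i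
    have h2 := relInfo_add a (fun j => z j t) zs i
    rw [relInfo_const] at h1
    rw [hzs] at h2
    rw [h1, h2, hxs, dotProduct_add, distRow_dotProduct_exoState]
    ring
  observer i t ht := hasDerivWithinAt_observer (he i t ht)
  aux i t ht := by
    refine ((htr.aux i t ht).add_const (zs i)).congr_deriv ?_
    have h1 := relInfo_add a (fun j => l j t) (fun _ => μ) i
    rw [relInfo_const] at h1
    rw [h1, add_zero]

/-- The auxiliary states keep their sum. -/
theorem IsClosedLoopTrajectory.sum_aux_eq (ha : IsUndirectedWeights a) {d : Fin N → ℝ → ℝ}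
    {x : ∀ i, ℝ → State (n i)} {lam : Fin N → ℝ → ℝ} {η : ∀ i, ℝ → ObsIdx (k i) → ℝ}
    {z : Fin N → ℝ → ℝ} (htr : IsClosedLoopTrajectory a w L γ g h f ur d x lam η z) :
    ∀ t ≥ 0, ∑ i, z i t = ∑ i, z i 0 := by
  intro t ht
  have hd : ∀ s ≥ 0, HasDerivWithinAt (fun s => ∑ i, z i s) 0 (Ici 0) s := fun s hs => by
    refine (HasDerivWithinAt.fun_sum fun i _ => htr.aux i s hs).congr_deriv ?_
    exact ha.sum_relInfo _
  refine constant_of_has_deriv_right_zero (a := 0) (b := t)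
    (fun s hs => ((hd s hs.1).continuousWithinAt).mono Icc_subset_Ici_self)
    (fun s hs => (hd s hs.1).mono (Ici_subset_Ici.2 hs.1)) t (right_mem_Icc.2 ht)

end Conversion

/-- The disturbance parts of the observer errors decay at a rate fixed by the observers. -/
theorem exists_rate_distRow {N : ℕ} {k : Fin N → ℕ} {w : ∀ i, Fin (k i) → ℝ}
    {L : ∀ i, ObsIdx (k i) → ℝ} (hL : ∀ i, IsHurwitz (observerMatrix (w i) (L i))) :
    ∃ r > 0, ∀ e : ∀ i, ℝ → ObsIdx (k i) → ℝ,
      (∀ i, ∀ t ≥ 0, HasDerivWithinAt (e i) ((observerMatrix (w i) (L i)).mulVec (e i t))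
        (Ici 0) t) →
      ∃ K : ℝ, 0 ≤ K ∧ ∀ t ≥ 0, ∀ i, |distRow (k i) ⬝ᵥ e i t| ≤ K * Real.exp (-r * t) := by
  choose r hr hdecay using fun i => (hL i).exists_rate
  obtain ⟨r', hr', hrr⟩ := exists_pos_forall_le hr
  refine ⟨r', hr', fun e he => ?_⟩
  choose K hK0 hK using fun i => hdecay i (e i) (he i)
  obtain ⟨B, hB, hKB⟩ := exists_pos_forall_ge fun i => ∑ j, |distRow (k i) j| * K i
  refine ⟨B, hB.le, fun t ht i => ?_⟩
  calc |distRow (k i) ⬝ᵥ e i t| ≤ ∑ j, |distRow (k i) j * e i t j| :=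
        Finset.abs_sum_le_sum_abs _ _
    _ ≤ ∑ j, |distRow (k i) j| * (K i * Real.exp (-r i * t)) :=
        Finset.sum_le_sum fun j _ => by
          rw [abs_mul]
          exact mul_le_mul_of_nonneg_left (hK i t ht j) (abs_nonneg _)
    _ = (∑ j, |distRow (k i) j| * K i) * Real.exp (-r i * t) := by
        rw [Finset.sum_mul]
        exact Finset.sum_congr rfl fun j _ => by ring
    _ ≤ B * Real.exp (-r' * t) := by
        refine mul_le_mul (hKB i) (Real.exp_le_exp.2 ?_) (Real.exp_pos _).le hB.le
        nlinarith [hrr i]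

/-! ### The coordination theorem -/

theorem theorem2 {N : ℕ} {k : Fin N → ℕ}
    -- the connected communication graph
    (a : Matrix (Fin N) (Fin N) ℝ) (ha : IsUndirectedWeights a)
    (hconn : (weightGraph a).Connected)
    -- the known disturbance frequencies and the observer gains
    (w : ∀ i, Fin (k i) → ℝ) (hw_pos : ∀ i j, 0 < w i j)
    (hw_inj : ∀ i, Function.Injective (w i))
    (L : ∀ i, ObsIdx (k i) → ℝ) (hL : ∀ i, IsHurwitz (observerMatrix (w i) (L i)))
    -- the convexity moduli and the Lipschitz constants
    (lo : Fin N → ℝ) (hlo : ∀ i, 0 < lo i) (M : Fin N → ℝ≥0) :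
    ∃ γ₀ : ℝ, ∀ γ > γ₀,
      -- the agents, the costs, the optimal allocation and the regulator functions
      ∀ (n : Fin N → ℕ) (g : ∀ i, State (n i) → ℝ → State (n i)) (h : ∀ i, State (n i) → ℝ)
        (f : Fin N → ℝ → ℝ) (d0 ystar : Fin N → ℝ)
        (xr : ∀ i, ℝ → State (n i)) (ur : Fin N → ℝ → ℝ),
        (∀ i, ContDiff ℝ ∞ (fun p : State (n i) × ℝ => g i p.1 p.2)) →
        (∀ i, ContDiff ℝ ∞ (h i)) →
        (∀ i, IsCost (lo i) (f i)) →
        IsOptimalAllocation f d0 ystar →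
        (∀ i, IsRegulator (g i) (h i) (xr i) (ur i)) →
        (∀ i, LipschitzWith (M i) (ur i)) →
        (∀ i, IsPassiveAt (g i) (h i) (xr i (ystar i)) (ur i (ystar i))) →
        (∀ i, IsExpPassiveAt (g i) (h i) (xr i (ystar i)) (ur i (ystar i))) →
        -- the rate does not depend on the disturbances or on the initial values
        ∃ c > 0, ∀ A φ : ∀ i, Fin (k i) → ℝ,
          -- every initial value admits a trajectory on `[0, ∞)`
          (∀ (x₀ : ∀ i, State (n i)) (lam₀ : Fin N → ℝ) (η₀ : ∀ i, ObsIdx (k i) → ℝ)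
              (z₀ : Fin N → ℝ),
            ∃ (x : ∀ i, ℝ → State (n i)) (lam : Fin N → ℝ → ℝ)
              (η : ∀ i, ℝ → ObsIdx (k i) → ℝ) (z : Fin N → ℝ → ℝ),
              IsClosedLoopTrajectory a w L γ g h f ur
                (fun i => observation (d0 i) (w i) (A i) (φ i)) x lam η z ∧
              ∀ i, x i 0 = x₀ i ∧ lam i 0 = lam₀ i ∧ η i 0 = η₀ i ∧ z i 0 = z₀ i) ∧
          -- every trajectory is bounded in the agents and its outputs converge exponentially
          (∀ (x : ∀ i, ℝ → State (n i)) (lam : Fin N → ℝ → ℝ)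
              (η : ∀ i, ℝ → ObsIdx (k i) → ℝ) (z : Fin N → ℝ → ℝ),
            IsClosedLoopTrajectory a w L γ g h f ur
              (fun i => observation (d0 i) (w i) (A i) (φ i)) x lam η z →
            (∀ i, ∃ B : ℝ, ∀ t ≥ 0, ‖x i t‖ ≤ B) ∧
            ∃ C : ℝ, ∀ i, ∀ t ≥ 0, |h i (x i t) - ystar i| ≤ C * Real.exp (-c * t)) := by
  obtain ⟨i₀⟩ := hconn.nonempty
  have : NeZero N := ⟨fun h0 => by subst h0; exact i₀.elim0⟩
  obtain ⟨r, hr, hdist⟩ := exists_rate_distRow hL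
  -- A positive upper bound of all `M i / lo i`.
  obtain ⟨γ₀, hγ₀, hγM⟩ := exists_pos_forall_ge fun i => (M i : ℝ) / lo i
  refine ⟨γ₀, fun γ hγ n g h f d0 ystar xr ur hg hh hf hopt hreg hLip _ hexp => ?_⟩
  have hγ0 : 0 ≤ γ := (hγ₀.trans hγ).le
  choose V c₁ c₂ c₃ κ hc₁ hc₂ hc₃ hκ hagent using fun i =>
    exists_isDissipativeAgent (hg i) (hh i) (hf i) (hreg i) (hLip i) (hexp i) hγ0
      ((div_le_iff₀ (hlo i)).1 ((hγM i).trans hγ.le))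
  obtain ⟨b₁, hb₁, hcb₁⟩ := exists_pos_forall_le hc₁
  obtain ⟨b₂, hb₂, hcb₂⟩ := exists_pos_forall_ge c₂
  obtain ⟨b₃, hb₃, hcb₃⟩ := exists_pos_forall_le hc₃
  obtain ⟨κ', hκ', hκκ⟩ := exists_pos_forall_le hκ
  have hG := fun i => (hagent i).mono (hcb₁ i) (hcb₂ i) (hcb₃ i) (hκκ i)
  have hxs : ∀ i, h i (xr i (ystar i)) = ystar i := fun i => (hreg i).output _
  have hμ : ∀ i, γ * deriv (f i) (ystar i) = γ * deriv (f i₀) (ystar i₀) := fun i => by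
    rw [hopt.deriv_eq (fun i => (hf i).smooth.differentiable two_ne_zero) i i₀]
  have hbal : ∑ i, (d0 i - ystar i) = 0 := by
    rw [Finset.sum_sub_distrib, hopt.1, sub_self]
  obtain ⟨ρ, hρ, hconv⟩ := exists_output_rate ha hconn hb₁ hb₂ hb₃ hκ' hG hr
  refine ⟨ρ, hρ, fun A φ => ⟨fun x₀ lam₀ η₀ z₀ => ?_, fun x lam η z htr => ?_⟩⟩
  -- For existence any equilibrium value of `z` will do; the sum 0 is arbitrary.
  · obtain ⟨zs, hzs, -⟩ := ha.exists_relInfo_eq hconn hbal 0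
    obtain ⟨x, l, e, z, htr, he, h0⟩ := exists_errorTrajectory ha hb₁ hb₃ hG w L x₀
      (fun i => lam₀ i - γ * deriv (f i₀) (ystar i₀))
      (fun i => η₀ i - exoState (d0 i) (w i) (A i) (φ i) 0) (fun i => z₀ i - zs i)
    refine ⟨x, _, _, _, htr.isClosedLoopTrajectory hxs hμ hzs he, fun i => ?_⟩
    obtain ⟨e1, e2, e3, e4⟩ := h0 i
    exact ⟨e1, by simp [e2], by simp [e3], by simp [e4]⟩
  -- The sum of `z` is conserved, so the equilibrium is chosen with the same sum; the error of `z`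
  -- then has zero sum for all times.
  · obtain ⟨zs, hzs, hsum⟩ := ha.exists_relInfo_eq hconn hbal (∑ i, z i 0)
    obtain ⟨K, hK, hε⟩ := hdist (fun i t => η i t - exoState (d0 i) (w i) (A i) (φ i) t)
      fun i t ht => hasDerivWithinAt_observer_error (htr.observer i t ht)
    obtain ⟨⟨R, hR⟩, C, hC⟩ := hconv _ _ _ _ K (htr.isErrorTrajectory hxs hμ hzs) hK hε
      fun t ht => by rw [Finset.sum_sub_distrib, htr.sum_aux_eq ha t ht, hsum, sub_self]
    refine ⟨fun i => ⟨R + ‖xr i (ystar i)‖, fun t ht => ?_⟩, C, fun i t ht => ?_⟩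
    · have h1 := norm_add_le (x i t - xr i (ystar i)) (xr i (ystar i))
      rw [sub_add_cancel] at h1
      linarith [hR t ht i]
    · rw [← hxs i]
      exact hC i t ht
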